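/- Let $S=\mathbb{C}[x_0,\dots,x_n]$ and let $f\in S$ be a nonzero homogeneous polynomial of degree $d\ge 1$. Assume that the hypersurface $V(f)\subset\mathbb{P}^n$ has (at most) isolated singularities, i.e. that $f$ and all its partial derivatives $f_0,\dots,f_n$ vanish simultaneously at only finitely many points of $\mathbb{P}^n$, and let $a_1,\dots,a_p$ be these (pairwise distinct) points. Let $J_f=(f_0,\dots,f_n)$ be the Jacobian ideal, let $h_k(f)\subset S$ be the ideal generated by all $k\times k$ minors of the Hessian matrix $(\partial^2 f/\partial x_i\partial x_j)_{0\le i,j\le n}$, and let $H_k(f)=S/(J_f+h_k(f))$, a graded $\mathbb{C}$-algebra with degree $m$ component $H_k(f)_m$. For a germ $g$ in the ring $\mathcal{O}_n$ of germs at the origin of analytic functions on $\mathbb{C}^n$, let $J_g$ be the ideal generated by the first order partial derivatives of $g$, let $h_k(g)$ be the ideal generated by all $k\times k$ minors of the $n\times n$ Hessian matrix of $g$ (so $h_{n+1}(g)=0$), and put $\chi_k(g)=\dim_{\mathbb{C}}\mathcal{O}_n/((g)+J_g+h_k(g))$. Let $\chi_k(V(f),a_i)=\chi_k(g_i)$,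 where $g_i\in\mathcal{O}_n$ is any equation of the hypersurface germ $(V(f),a_i)$ in local analytic coordinates of $\mathbb{P}^n$ centred at $a_i$. Then, for every $k=1,2,\dots,n+1$, there is an integer $m_0$ such that for all $m\ge m_0$ (and for any choice of the local equations $g_i$) $$\dim_{\mathbb{C}} H_k(f)_m=\sum_{i=1}^{p}\chi_k(V(f),a_i).$$ -/

import Mathlib

open Filter Topology
open scoped LinearAlgebra.Projectivization

noncomputable section

/-! ### Minors and Hessian ideals -/

/-- The ideal generated by all `k × k` minors of a square matrix `M`: the rows and the columns are
selected by strictly increasing maps. If `k` exceeds the size of `M` there is no minor and the ideal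
is zero. -/
def minorsIdeal {N : ℕ} {R : Type*} [CommRing R] (k : ℕ) (M : Matrix (Fin N) (Fin N) R) : Ideal R :=
  Ideal.span {x | ∃ r c : Fin k ↪o Fin N, x = (M.submatrix r c).det}

/-! ### The graded Hessian algebras of a homogeneous polynomial in `x_0, …, x_n` -/

/-- The Jacobian ideal `J_f`, generated by all first order partial derivatives of `f`. -/
def jacobianIdeal {n : ℕ} (f : MvPolynomial (Fin (n + 1)) ℂ) :
    Ideal (MvPolynomial (Fin (n + 1)) ℂ) :=
  Ideal.span (Set.range fun i => MvPolynomial.pderiv i f)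

/-- The Hessian matrix of the second order partial derivatives of `f`. -/
def hessianMatrix {n : ℕ} (f : MvPolynomial (Fin (n + 1)) ℂ) :
    Matrix (Fin (n + 1)) (Fin (n + 1)) (MvPolynomial (Fin (n + 1)) ℂ) :=
  Matrix.of fun i j => MvPolynomial.pderiv i (MvPolynomial.pderiv j f)

/-- The `k`-th Hessian algebra `H_k(f) = S / (J_f + h_k(f))`. -/
abbrev HessianAlgebra {n : ℕ} (k : ℕ) (f : MvPolynomial (Fin (n + 1)) ℂ) : Type :=
  MvPolynomial (Fin (n + 1)) ℂ ⧸ (jacobianIdeal f ⊔ minorsIdeal k (hessianMatrix f))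

/-- The degree `m` component `H_k(f)_m`: the image of the space of homogeneous polynomials of
degree `m` in `H_k(f)`. -/
def hessianAlgebraPiece {n : ℕ} (k : ℕ) (f : MvPolynomial (Fin (n + 1)) ℂ) (m : ℕ) :
    Submodule ℂ (HessianAlgebra k f) :=
  (MvPolynomial.homogeneousSubmodule (Fin (n + 1)) ℂ m).map
    (Ideal.Quotient.mkₐ ℂ (jacobianIdeal f ⊔ minorsIdeal k (hessianMatrix f))).toLinearMap

/-- The singular locus of the projective hypersurface `f = 0`: the points of projective space at
which `f` and all its first order partial derivatives vanish (for homogeneous `f` this does not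
depend on the representative of the point). -/
def singularLocus {n : ℕ} (f : MvPolynomial (Fin (n + 1)) ℂ) : Set (ℙ ℂ (Fin (n + 1) → ℂ)) :=
  {a | MvPolynomial.eval a.rep f = 0 ∧
    ∀ i, MvPolynomial.eval a.rep (MvPolynomial.pderiv i f) = 0}

/-! ### The local ring of analytic germs at the origin of `ℂⁿ` -/

/-- Germs of complex valued functions form a `ℂ`-algebra, with the pointwise operations. -/
instance germAlgebra {α : Type*} (l : Filter α) : Algebra ℂ (Germ l ℂ) :=
  Algebra.ofModule
    (by rintro r ⟨x⟩ ⟨y⟩; exact congrArg (Germ.ofFun (l := l)) (smul_mul_assoc r x y))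
    (by rintro r ⟨x⟩ ⟨y⟩; exact congrArg (Germ.ofFun (l := l)) (mul_smul_comm r x y))

/-- The ring `𝓞_n` of germs at the origin of `ℂⁿ` of analytic functions. -/
def analyticGerms (n : ℕ) : Subalgebra ℂ (Germ (𝓝 (0 : Fin n → ℂ)) ℂ) where
  carrier := {g | ∃ F : (Fin n → ℂ) → ℂ, AnalyticAt ℂ F 0 ∧ g = Germ.ofFun F}
  mul_mem' := by
    rintro _ _ ⟨F, hF, rfl⟩ ⟨G, hG, rfl⟩
    exact ⟨F * G, hF.mul hG, rfl⟩
  add_mem' := by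
    rintro _ _ ⟨F, hF, rfl⟩ ⟨G, hG, rfl⟩
    exact ⟨F + G, hF.add hG, rfl⟩
  algebraMap_mem' r := by
    refine ⟨r • (1 : (Fin n → ℂ) → ℂ), ?_, ?_⟩
    · exact analyticAt_const (v := r • (1 : ℂ))
    · rw [Algebra.algebraMap_eq_smul_one]
      rfl

/-- The operation on germs induced by `∂/∂y_i`. -/
def germPartial {n : ℕ} (i : Fin n) :
    Germ (𝓝 (0 : Fin n → ℂ)) ℂ → Germ (𝓝 (0 : Fin n → ℂ)) ℂ :=
  Germ.map' (fun F y => fderiv ℂ F y (Pi.single i 1)) fun _ _ h =>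
    (EventuallyEq.fderiv h).fun_comp fun L : (Fin n → ℂ) →L[ℂ] ℂ => L (Pi.single i 1)

/-- The partial derivative `∂g/∂y_i` of an analytic germ `g`. -/
def analyticGerms.partial {n : ℕ} (i : Fin n) (g : analyticGerms n) : analyticGerms n :=
  ⟨germPartial i g, by
    obtain ⟨_, F, hF, rfl⟩ := g
    exact ⟨fun y => fderiv ℂ F y (Pi.single i 1), 
      ((ContinuousLinearMap.apply ℂ ℂ (Pi.single i 1 : Fin n → ℂ)).analyticAt _).comp hF.fderiv, rfl⟩⟩

/-- The Hessian matrix of an analytic germ `g`. -/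
def localHessianMatrix {n : ℕ} (g : analyticGerms n) :
    Matrix (Fin n) (Fin n) (analyticGerms n) :=
  Matrix.of fun i j => analyticGerms.partial i (analyticGerms.partial j g)

/-- The ideal `(g) + J_g + h_k(g)` of `𝓞_n`. Note that `h_{n+1}(g) = 0`. -/
def localHessianIdeal {n : ℕ} (k : ℕ) (g : analyticGerms n) : Ideal (analyticGerms n) :=
  Ideal.span {g} ⊔ Ideal.span (Set.range fun i => analyticGerms.partial i g) ⊔
    minorsIdeal k (localHessianMatrix g)

/-- The local `k`-th Hessian algebra `H_k(g) = 𝓞_n / ((g) + J_g + h_k(g))`. -/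
abbrev LocalHessianAlgebra {n : ℕ} (k : ℕ) (g : analyticGerms n) : Type :=
  analyticGerms n ⧸ localHessianIdeal k g

/-- The `k`-th Hessian number `χ_k(g)`, the dimension of `H_k(g)` as a complex vector space
(a cardinal, so that an infinite dimension is not confused with `0`). -/
def hessianNumber {n : ℕ} (k : ℕ) (g : analyticGerms n) : Cardinal :=
  Module.rank ℂ (LocalHessianAlgebra k g)

/-! ### Local equations of a projective hypersurface -/

/-- `φ : ℂⁿ → ℂⁿ⁺¹` lifts an analytic local parametrization of projective space that sends the
origin to `a`: it is analytic at the origin, `φ 0` represents `a`, and `y ↦ [φ y]` is a local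
biholomorphism at the origin, that is, `(t, y) ↦ t • φ y` has an injective differential
at `(1, 0)`. -/
structure IsLocalParametrization {n : ℕ} (a : ℙ ℂ (Fin (n + 1) → ℂ))
    (φ : (Fin n → ℂ) → (Fin (n + 1) → ℂ)) : Prop where
  analyticAt : AnalyticAt ℂ φ 0
  center : ∃ h : φ 0 ≠ 0, Projectivization.mk ℂ (φ 0) h = a
  injective : Function.Injective
    fun z : ℂ × (Fin n → ℂ) => z.1 • φ 0 + fderiv ℂ φ 0 z.2

/-- `g` is an equation of the hypersurface germ `(V(f), a)` in some system of local analytic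
coordinates of projective space centred at `a`: up to a unit, `g` is the germ at the origin of
`f ∘ φ` with `φ` (a lift of) a local parametrization at `a`. -/
def IsLocalEquation {n : ℕ} (f : MvPolynomial (Fin (n + 1)) ℂ) (a : ℙ ℂ (Fin (n + 1) → ℂ))
    (g : analyticGerms n) : Prop :=
  ∃ (φ : (Fin n → ℂ) → (Fin (n + 1) → ℂ)) (u : (Fin n → ℂ) → ℂ),
    IsLocalParametrization a φ ∧ AnalyticAt ℂ u 0 ∧ u 0 ≠ 0 ∧
      (g : Germ (𝓝 (0 : Fin n → ℂ)) ℂ) =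
        Germ.ofFun fun y => u y * MvPolynomial.eval (φ y) f

/-- Every hypersurface germ has a local equation, given by an affine chart of projective space. -/
theorem exists_isLocalEquation {n : ℕ} (f : MvPolynomial (Fin (n + 1)) ℂ)
    (a : ℙ ℂ (Fin (n + 1) → ℂ)) : ∃ g, IsLocalEquation f a g := by
  obtain ⟨j, hj⟩ : ∃ j, a.rep j ≠ 0 := Function.ne_iff.1 a.rep_nonzero
  let L : (Fin n → ℂ) →L[ℂ] (Fin (n + 1) → ℂ) :=
    ContinuousLinearMap.pi
      (j.insertNth (0 : (Fin n → ℂ) →L[ℂ] ℂ) fun i => ContinuousLinearMap.proj i)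
  have hLj : ∀ y, L y j = 0 := fun y => by simp [L]
  have hLi : ∀ y i, L y (j.succAbove i) = y i := fun y i => by simp [L]
  let φ : (Fin n → ℂ) → (Fin (n + 1) → ℂ) := fun y => a.rep + L y
  have hφ : AnalyticAt ℂ φ 0 := analyticAt_const.add (L.analyticAt 0)
  have hφ0 : φ 0 = a.rep := by simp [φ]
  have hd : fderiv ℂ φ 0 = L := (L.hasFDerivAt.const_add a.rep).fderiv
  have hE : AnalyticAt ℂ (fun y => MvPolynomial.eval (φ y) f) 0 := by
    have := AnalyticAt.aeval_mvPolynomial (f := φ) (fun i => (analyticAt_pi_iff.1 hφ) i) f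
    simpa [MvPolynomial.aeval_eq_eval] using this
  refine ⟨⟨_, fun y => 1 * MvPolynomial.eval (φ y) f, by simpa using hE, rfl⟩, φ, fun _ => 1,
    ⟨hφ, ⟨hφ0 ▸ a.rep_nonzero, ?_⟩, ?_⟩, analyticAt_const, one_ne_zero, rfl⟩
  · simp only [hφ0, Projectivization.mk_rep]
  · rintro ⟨s, y⟩ ⟨t, z⟩ h
    simp only [hφ0, hd] at h
    have hst : s = t := by
      have := congrFun h j
      simpa [hLj, hj] using this
    subst hst
    refine Prod.ext rfl (funext fun i => ?_)
    have := congrFun h (j.succAbove i)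
    simpa [hLi] using this

end

/-! ### Ideals of minors -/

section Minors

variable {N k : ℕ} {R : Type*} [CommRing R]

theorem det_submatrix_mem_minorsIdeal (M : Matrix (Fin N) (Fin N) R) (r c : Fin k → Fin N) :
    (M.submatrix r c).det ∈ minorsIdeal k M := by
  by_cases hr : Function.Injective r
  swap
  · obtain ⟨i, j, hij, hne⟩ : ∃ i j, r i = r j ∧ i ≠ j := by
      simpa [Function.Injective] using hr
    rw [Matrix.det_zero_of_row_eq hne (by ext l; simp [hij])]
    exact zero_mem _
  by_cases hc : Function.Injective c
  swap
  · obtain ⟨i, j, hij, hne⟩ : ∃ i j, c i = c j ∧ i ≠ j := by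
      simpa [Function.Injective] using hc
    rw [Matrix.det_zero_of_column_eq hne (by intro l; simp [hij])]
    exact zero_mem _
  have key : ∀ s : Fin k → Fin N, Function.Injective s →
      ∃ (e : Fin k ↪o Fin N) (σ : Equiv.Perm (Fin k)), s = e ∘ σ := fun s hs =>
    ⟨OrderEmbedding.ofStrictMono (s ∘ Tuple.sort s)
      ((Tuple.monotone_sort s).strictMono_of_injective (hs.comp (Equiv.injective _))),
      (Tuple.sort s)⁻¹, by ext i; simp⟩
  obtain ⟨e, σ, rfl⟩ := key r hr
  obtain ⟨e', τ, rfl⟩ := key c hc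
  have h1 : M.submatrix (e ∘ σ) (e' ∘ τ) =
      ((M.submatrix e e').submatrix σ id).submatrix id τ := by ext; simp
  rw [h1, Matrix.det_permute', Matrix.det_permute]
  exact Ideal.mul_mem_left _ _ (Ideal.mul_mem_left _ _ (Ideal.subset_span ⟨e, e', rfl⟩))

theorem minorsIdeal_le_iff {M : Matrix (Fin N) (Fin N) R} {I : Ideal R} :
    minorsIdeal k M ≤ I ↔ ∀ r c : Fin k ↪o Fin N, (M.submatrix r c).det ∈ I := by
  rw [minorsIdeal, Ideal.span_le]
  constructor
  · exact fun h r c => h ⟨r, c, rfl⟩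
  · rintro h _ ⟨r, c, rfl⟩
    exact h r c

theorem minorsIdeal_transpose (M : Matrix (Fin N) (Fin N) R) :
    minorsIdeal k M.transpose = minorsIdeal k M := by
  have key : ∀ M : Matrix (Fin N) (Fin N) R, minorsIdeal k M.transpose ≤ minorsIdeal k M := by
    intro M
    refine minorsIdeal_le_iff.2 fun r c => ?_
    rw [← Matrix.transpose_submatrix, Matrix.det_transpose]
    exact det_submatrix_mem_minorsIdeal M c r
  exact le_antisymm (key M) (by simpa using key M.transpose)

theorem minorsIdeal_mul_le_right (A B : Matrix (Fin N) (Fin N) R) :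
    minorsIdeal k (A * B) ≤ minorsIdeal k B := by
  refine minorsIdeal_le_iff.2 fun r c => ?_
  have h : (A * B).submatrix r c =
      fun i => ∑ l, A (r i) l • fun j => B l (c j) := by
    ext i j
    simp [Matrix.mul_apply, Finset.sum_apply]
  rw [h]
  change Matrix.detRowAlternating.toMultilinearMap (fun i => ∑ l, A (r i) l • fun j => B l (c j)) ∈ _
  rw [MultilinearMap.map_sum]
  refine Ideal.sum_mem _ fun s _ => ?_
  rw [MultilinearMap.map_smul_univ]
  exact Ideal.mul_mem_left _ _ (det_submatrix_mem_minorsIdeal B s c)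

theorem minorsIdeal_mul_le_left (A B : Matrix (Fin N) (Fin N) R) :
    minorsIdeal k (A * B) ≤ minorsIdeal k A := by
  rw [← minorsIdeal_transpose, Matrix.transpose_mul, ← minorsIdeal_transpose A]
  exact minorsIdeal_mul_le_right _ _

theorem minorsIdeal_transpose_mul_mul {P Q : Matrix (Fin N) (Fin N) R} (h : P * Q = 1)
    (H : Matrix (Fin N) (Fin N) R) :
    minorsIdeal k (P.transpose * H * P) = minorsIdeal k H := by
  refine le_antisymm ((minorsIdeal_mul_le_left _ _).trans (minorsIdeal_mul_le_right _ _)) ?_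
  have hQ : Q.transpose * P.transpose = 1 := by rw [← Matrix.transpose_mul, h, Matrix.transpose_one]
  calc minorsIdeal k H = minorsIdeal k (Q.transpose * (P.transpose * H * P) * Q) := by
        congr 1
        calc H = (Q.transpose * P.transpose) * H * (P * Q) := by simp [h, hQ]
          _ = _ := by simp only [Matrix.mul_assoc]
    _ ≤ _ := (minorsIdeal_mul_le_left _ _).trans (minorsIdeal_mul_le_right _ _)

theorem minorsIdeal_smul {u : R} (hu : IsUnit u) (M : Matrix (Fin N) (Fin N) R) :
    minorsIdeal k (u • M) = minorsIdeal k M := by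
  have key : ∀ (v : R) (M : Matrix (Fin N) (Fin N) R), minorsIdeal k (v • M) ≤ minorsIdeal k M := by
    intro v M
    have : v • M = (v • (1 : Matrix (Fin N) (Fin N) R)) * M := by simp
    rw [this]
    exact minorsIdeal_mul_le_right _ _
  obtain ⟨v, hv⟩ := hu.exists_left_inv
  refine le_antisymm (key u M) ?_
  simpa [smul_smul, hv] using key v (u • M)

theorem map_minorsIdeal {R' : Type*} [CommRing R'] (φ : R →+* R') (M : Matrix (Fin N) (Fin N) R) :
    (minorsIdeal k M).map φ = minorsIdeal k (M.map φ) := by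
  have hd : ∀ r c : Fin k → Fin N,
      φ (M.submatrix r c).det = ((M.map φ).submatrix r c).det := fun r c => by
    rw [RingHom.map_det]; rfl
  refine le_antisymm ?_ (minorsIdeal_le_iff.2 fun r c => ?_)
  · rw [Ideal.map_le_iff_le_comap]
    refine minorsIdeal_le_iff.2 fun r c => ?_
    rw [Ideal.mem_comap, hd]
    exact det_submatrix_mem_minorsIdeal _ _ _
  · rw [← hd]
    exact Ideal.mem_map_of_mem _ (det_submatrix_mem_minorsIdeal _ _ _)

theorem minorsIdeal_of_zero_border {M : Matrix (Fin (N + 1)) (Fin (N + 1)) R}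
    (hr : ∀ j, M 0 j = 0) (hc : ∀ i, M i 0 = 0) :
    minorsIdeal k M = minorsIdeal k (M.submatrix Fin.succ Fin.succ) := by
  refine le_antisymm (minorsIdeal_le_iff.2 fun r c => ?_) (minorsIdeal_le_iff.2 fun r c => ?_)
  · by_cases h : ∃ i, r i = 0
    · obtain ⟨i, hi⟩ := h
      rw [Matrix.det_eq_zero_of_row_eq_zero i (by simp [hi, hr])]
      exact zero_mem _
    by_cases h' : ∃ i, c i = 0
    · obtain ⟨i, hi⟩ := h'
      rw [Matrix.det_eq_zero_of_column_eq_zero i (by simp [hi, hc])]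
      exact zero_mem _
    push Not at h h'
    have : M.submatrix r c = (M.submatrix Fin.succ Fin.succ).submatrix
        (fun i => (r i).pred (h i)) (fun i => (c i).pred (h' i)) := by ext; simp
    rw [this]
    exact det_submatrix_mem_minorsIdeal _ _ _
  · exact det_submatrix_mem_minorsIdeal M (Fin.succ ∘ r) (Fin.succ ∘ c)

theorem sup_eq_sup_of_map_mk_eq {J A B : Ideal R}
    (h : A.map (Ideal.Quotient.mk J) = B.map (Ideal.Quotient.mk J)) : J ⊔ A = J ⊔ B := by
  have := congrArg (Ideal.comap (Ideal.Quotient.mk J)) h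
  rwa [Ideal.comap_map_of_surjective _ Ideal.Quotient.mk_surjective,
    Ideal.comap_map_of_surjective _ Ideal.Quotient.mk_surjective, ← RingHom.ker_eq_comap_bot,
    Ideal.mk_ker, sup_comm A, sup_comm B] at this

end Minors

/-! ### Hessian ideals along an invertible substitution -/

section Substitution

open MvPolynomial

variable {n : ℕ} {O : Type*} [CommRing O] [Algebra ℂ O]

theorem Derivation.apply_aeval {σ : Type*} [Fintype σ] (D : Derivation ℂ O O) (φ : σ → O)
    (F : MvPolynomial σ ℂ) :
    D (aeval φ F) = ∑ i, aeval φ (pderiv i F) * D (φ i) := by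
  classical
  induction F using MvPolynomial.induction_on with
  | C a => simp [← MvPolynomial.algebraMap_eq]
  | add p q hp hq => simp [hp, hq, add_mul, Finset.sum_add_distrib]
  | mul_X p i hp =>
    simp only [map_mul, aeval_X, Derivation.leibniz, hp, map_add, smul_eq_mul, add_mul,
      Finset.sum_add_distrib, pderiv_X]
    congr 1
    · rw [Finset.sum_eq_single i]
      · simp
      · intro j _ hj
        simp [hj.symm]
      · simp
    · rw [Finset.mul_sum]
      exact Finset.sum_congr rfl fun j _ => by ring

/-- The matrix with columns `φ, D_1 φ, …, D_n φ`. -/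
def frameMatrix (D : Fin n → Derivation ℂ O O) (φ : Fin (n + 1) → O) :
    Matrix (Fin (n + 1)) (Fin (n + 1)) O :=
  Matrix.of fun i => Fin.cons (φ i) fun j => D j (φ i)

theorem map_jacobianIdeal_eq (D : Fin n → Derivation ℂ O O) (φ : Fin (n + 1) → O)
    (hP : IsUnit (frameMatrix D φ)) {d : ℕ} (hd : 0 < d) {f : MvPolynomial (Fin (n + 1)) ℂ}
    (hf : f.IsHomogeneous d) :
    (jacobianIdeal f).map (aeval φ : _ →ₐ[ℂ] O) =
      Ideal.span {aeval φ f} ⊔ Ideal.span (Set.range fun j => D j (aeval φ f)) := by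
  set v : Fin (n + 1) → O := fun i => aeval φ (pderiv i f) with hv
  set w : Fin (n + 1) → O := Matrix.vecMul v (frameMatrix D φ) with hw
  have hd' : (d : ℂ) ≠ 0 := by exact_mod_cast hd.ne'
  have hw0 : w 0 = (d : ℂ) • aeval φ f := by
    have := congrArg (aeval φ : _ →ₐ[ℂ] O) hf.sum_X_mul_pderiv
    simp only [map_sum, map_mul, aeval_X, map_nsmul] at this
    rw [Nat.cast_smul_eq_nsmul, ← this]
    simp [hw, Matrix.vecMul, dotProduct, frameMatrix, hv, mul_comm]
  have hws : ∀ j : Fin n, w j.succ = D j (aeval φ f) := fun j => by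
    rw [Derivation.apply_aeval]
    simp [hw, Matrix.vecMul, dotProduct, frameMatrix, hv]
  have hR : Ideal.span {aeval φ f} ⊔ Ideal.span (Set.range fun j => D j (aeval φ f)) =
      Ideal.span (Set.range w) := by
    apply le_antisymm
    · refine sup_le ?_ ?_
      · rw [Ideal.span_singleton_le_iff_mem]
        have : aeval φ f = algebraMap ℂ O (d : ℂ)⁻¹ * w 0 := by
          rw [hw0, ← Algebra.smul_def, smul_smul, inv_mul_cancel₀ hd', one_smul]
        rw [this]
        exact Ideal.mul_mem_left _ _ (Ideal.subset_span ⟨0, rfl⟩)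
      · rw [Ideal.span_le]
        rintro _ ⟨j, rfl⟩
        exact Ideal.subset_span ⟨j.succ, hws j⟩
    · rw [Ideal.span_le]
      rintro _ ⟨i, rfl⟩
      refine Fin.cases ?_ (fun j => ?_) i
      · rw [hw0, Algebra.smul_def]
        exact Ideal.mul_mem_left _ _ (Ideal.mem_sup_left (Ideal.mem_span_singleton_self _))
      · rw [hws]
        exact Ideal.mem_sup_right (Ideal.subset_span ⟨j, rfl⟩)
  have hL : (jacobianIdeal f).map (aeval φ : _ →ₐ[ℂ] O) = Ideal.span (Set.range v) := by
    rw [jacobianIdeal, Ideal.map_span, ← Set.range_comp]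
    rfl
  have key : ∀ (x : Fin (n + 1) → O) (A : Matrix (Fin (n + 1)) (Fin (n + 1)) O),
      Ideal.span (Set.range (Matrix.vecMul x A)) ≤ Ideal.span (Set.range x) := by
    intro x A
    rw [Ideal.span_le]
    rintro _ ⟨j, rfl⟩
    change ∑ i, x i * A i j ∈ Ideal.span (Set.range x)
    exact Ideal.sum_mem _ fun i _ =>
      Ideal.mul_mem_right _ _ (Ideal.subset_span (Set.mem_range_self i))
  rw [hL, hR]
  refine le_antisymm ?_ (key _ _)
  obtain ⟨Q, hQ⟩ := hP.exists_right_inv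
  have : v = Matrix.vecMul w Q := by rw [hw, Matrix.vecMul_vecMul, hQ, Matrix.vecMul_one]
  conv_lhs => rw [this]
  exact key _ _

theorem span_sup_span_unit_mul (D : Fin n → Derivation ℂ O O) {u : O} (hu : IsUnit u) (h : O) :
    Ideal.span {u * h} ⊔ Ideal.span (Set.range fun j => D j (u * h)) =
      Ideal.span {h} ⊔ Ideal.span (Set.range fun j => D j h) := by
  have key : ∀ (u h : O), Ideal.span {u * h} ⊔ Ideal.span (Set.range fun j => D j (u * h)) ≤
      Ideal.span {h} ⊔ Ideal.span (Set.range fun j => D j h) := by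
    intro u h
    have hh : h ∈ Ideal.span {h} ⊔ Ideal.span (Set.range fun j => D j h) :=
      Ideal.mem_sup_left (Ideal.subset_span rfl)
    refine sup_le ?_ ?_
    · rw [Ideal.span_singleton_le_iff_mem]
      exact Ideal.mul_mem_left _ _ hh
    · rw [Ideal.span_le]
      rintro _ ⟨j, rfl⟩
      simp only [Derivation.leibniz, smul_eq_mul, SetLike.mem_coe]
      exact add_mem (Ideal.mul_mem_left _ _ (Ideal.mem_sup_right (Ideal.subset_span ⟨j, rfl⟩)))
        (Ideal.mul_mem_right _ _ hh)
  obtain ⟨v, hv⟩ := hu.exists_left_inv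
  refine le_antisymm (key u h) ?_
  have := key v (u * h)
  rwa [← mul_assoc, hv, one_mul] at this

set_option maxHeartbeats 400000 in
theorem map_hessianIdeal_eq (D : Fin n → Derivation ℂ O O) (φ : Fin (n + 1) → O)
    (hP : IsUnit (frameMatrix D φ)) {d : ℕ} (hd : 0 < d) {f : MvPolynomial (Fin (n + 1)) ℂ}
    (hf : f.IsHomogeneous d) {u : O} (hu : IsUnit u) (k : ℕ) :
    (jacobianIdeal f ⊔ minorsIdeal k (hessianMatrix f)).map (aeval φ : _ →ₐ[ℂ] O) =
      Ideal.span {u * aeval φ f} ⊔ Ideal.span (Set.range fun j => D j (u * aeval φ f)) ⊔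
        minorsIdeal k (Matrix.of fun i j => D i (D j (u * aeval φ f))) := by
  set h := aeval φ f with hh
  rw [span_sup_span_unit_mul D hu, Ideal.map_sup, map_jacobianIdeal_eq D φ hP hd hf, ← hh]
  set J := Ideal.span {h} ⊔ Ideal.span (Set.range fun j => D j h) with hJ
  have hJf : (jacobianIdeal f).map (aeval φ : _ →ₐ[ℂ] O) = J := map_jacobianIdeal_eq D φ hP hd hf
  apply sup_eq_sup_of_map_mk_eq
  set π := Ideal.Quotient.mk J with hπ
  have h0 : π h = 0 := Ideal.Quotient.eq_zero_iff_mem.2 (Ideal.mem_sup_left (Ideal.subset_span rfl))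
  have h1 : ∀ j, π (D j h) = 0 := fun j =>
    Ideal.Quotient.eq_zero_iff_mem.2 (Ideal.mem_sup_right (Ideal.subset_span ⟨j, rfl⟩))
  have hp : ∀ i, π (aeval φ (pderiv i f)) = 0 := fun i => Ideal.Quotient.eq_zero_iff_mem.2 <| by
    rw [← hJf]
    exact Ideal.mem_map_of_mem _ (Ideal.subset_span ⟨i, rfl⟩)
  set H : Matrix (Fin (n + 1)) (Fin (n + 1)) (O ⧸ J) :=
    ((hessianMatrix f).map (aeval φ : _ →ₐ[ℂ] O)).map π with hH
  set P := (frameMatrix D φ).map π with hPdef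
  have hL : ((minorsIdeal k (hessianMatrix f)).map (aeval φ : _ →ₐ[ℂ] O)).map π =
      minorsIdeal k H := by
    rw [show (minorsIdeal k (hessianMatrix f)).map (aeval φ : _ →ₐ[ℂ] O) =
      minorsIdeal k ((hessianMatrix f).map (aeval φ : _ →ₐ[ℂ] O)) from
      map_minorsIdeal (aeval φ : _ →ₐ[ℂ] O).toRingHom (hessianMatrix f), map_minorsIdeal]
  have hR : (minorsIdeal k (Matrix.of fun i j => D i (D j (u * h)))).map π =
      minorsIdeal k (Matrix.of fun i j => π (D i (D j h))) := by
    rw [map_minorsIdeal]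
    conv_rhs => rw [← minorsIdeal_smul (hu.map π)]
    congr 1
    ext i j
    simp [Derivation.leibniz, h0, h1]
  have hHP : ∀ i, (H * P) i 0 = 0 := fun i => by
    have h2 := congrArg (fun x => π (aeval φ (pderiv i x))) hf.sum_X_mul_pderiv
    simp only [map_sum, Derivation.leibniz, pderiv_X, map_nsmul, hp, smul_zero, map_add, map_mul,
      smul_eq_mul, aeval_X, zero_mul, add_zero] at h2
    rw [Matrix.mul_apply, ← h2]
    refine Finset.sum_congr rfl fun j _ => ?_
    simp [hH, hPdef, frameMatrix, hessianMatrix, mul_comm]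
  have hPH : ∀ j, (P.transpose * H) 0 j = 0 := fun j => by
    have h2 := congrArg (fun x => π (aeval φ x)) (hf.pderiv (i := j)).sum_X_mul_pderiv
    simp only [map_sum, map_nsmul, hp, smul_zero, map_mul, aeval_X] at h2
    rw [Matrix.mul_apply, ← h2]
    refine Finset.sum_congr rfl fun i _ => ?_
    simp [hH, hPdef, frameMatrix, hessianMatrix]
  have hD : ∀ i j, π (D i (D j h)) = (P.transpose * H * P) i.succ j.succ := fun i j => by
    rw [hh, Derivation.apply_aeval (D j)]
    simp only [map_sum, Derivation.leibniz, smul_eq_mul, map_add, map_mul, hp, zero_mul, zero_add,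
      Derivation.apply_aeval (D i)]
    rw [Matrix.mul_apply]
    refine Finset.sum_congr rfl fun l _ => ?_
    rw [Matrix.mul_apply, mul_comm]
    simp only [hPdef, hH, frameMatrix, hessianMatrix, Matrix.transpose_apply, Matrix.map_apply,
      Matrix.of_apply, Fin.cons_succ]
    exact congrArg (· * _) (Finset.sum_congr rfl fun m _ => mul_comm _ _)
  obtain ⟨Q, hQ⟩ := hP.exists_right_inv
  have hQ' : P * Q.map π = 1 := by
    rw [hPdef, ← Matrix.map_mul, hQ, Matrix.map_one π (map_zero π) (map_one π)]
  rw [hL, hR, ← minorsIdeal_transpose_mul_mul hQ', minorsIdeal_of_zero_border]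
  · congr 1
    ext i j
    exact (hD i j).symm
  · intro j
    rw [Matrix.mul_apply]
    exact Finset.sum_eq_zero fun l _ => by rw [hPH, zero_mul]
  · intro i
    rw [Matrix.mul_assoc, Matrix.mul_apply]
    exact Finset.sum_eq_zero fun l _ => by rw [hHP, mul_zero]

end Substitution

/-! ### Graded quotients and dehomogenization -/

section Dehomogenization

open MvPolynomial

variable {σ : Type*}

theorem homogeneousComponent_succ_mul {ℓ : MvPolynomial σ ℂ} (hℓ : ℓ.IsHomogeneous 1) (m : ℕ)
    (H : MvPolynomial σ ℂ) :
    homogeneousComponent (m + 1) (ℓ * H) = ℓ * homogeneousComponent m H := by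
  conv_lhs => rw [← sum_homogeneousComponent H, Finset.mul_sum, map_sum]
  have h1 : ∀ i, homogeneousComponent (m + 1) (ℓ * homogeneousComponent i H) =
      if i = m then ℓ * homogeneousComponent i H else 0 := fun i => by
    rw [homogeneousComponent_of_mem (n := i + 1)]
    · simp only [Nat.add_right_cancel_iff, eq_comm]
    · rw [mem_homogeneousSubmodule, add_comm]
      exact hℓ.mul (homogeneousComponent_isHomogeneous i H)
  simp only [h1]
  rw [Finset.sum_ite_eq' _ m]
  split_ifs with h
  · rfl
  · rw [homogeneousComponent_eq_zero _ _ (by simpa using h), mul_zero]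

theorem homogeneousComponent_zero_mul {ℓ : MvPolynomial σ ℂ} (hℓ : ℓ.IsHomogeneous 1)
    (H : MvPolynomial σ ℂ) : homogeneousComponent 0 (ℓ * H) = 0 := by
  have : coeff 0 ℓ = 0 := hℓ.coeff_eq_zero (by simp)
  rw [homogeneousComponent_zero, ← constantCoeff_eq, map_mul, constantCoeff_eq, this, zero_mul,
    map_zero]

variable {I : Ideal (MvPolynomial σ ℂ)} {ℓ : MvPolynomial σ ℂ}

/-- A homogeneous polynomial lying in `I + (ℓ - 1)` is killed by a power of `ℓ` modulo `I`. -/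
theorem exists_pow_mul_mem_of_mem_sup (hI : ∀ F ∈ I, ∀ m, homogeneousComponent m F ∈ I)
    (hℓ : ℓ.IsHomogeneous 1) {m : ℕ} {F : MvPolynomial σ ℂ} (hF : F.IsHomogeneous m)
    (h : F ∈ I ⊔ Ideal.span {ℓ - 1}) : ∃ t, ℓ ^ t * F ∈ I := by
  obtain ⟨i, hi, y, hy, rfl⟩ := Submodule.mem_sup.1 h
  obtain ⟨H, rfl⟩ := Ideal.mem_span_singleton'.1 hy
  set F := i + H * (ℓ - 1) with hFdef
  have hc0 : homogeneousComponent 0 F + homogeneousComponent 0 H ∈ I := by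
    have : homogeneousComponent 0 F + homogeneousComponent 0 H = homogeneousComponent 0 i := by
      rw [hFdef, show i + H * (ℓ - 1) = i + ℓ * H - H by ring, map_sub, map_add,
        homogeneousComponent_zero_mul hℓ]
      ring
    rw [this]
    exact hI i hi 0
  have hcs : ∀ j, homogeneousComponent (j + 1) F + homogeneousComponent (j + 1) H -
      ℓ * homogeneousComponent j H ∈ I := fun j => by
    have : homogeneousComponent (j + 1) F + homogeneousComponent (j + 1) H -
        ℓ * homogeneousComponent j H = homogeneousComponent (j + 1) i := by
      rw [hFdef, show i + H * (ℓ - 1) = i + ℓ * H - H by ring, map_sub, map_add,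
        homogeneousComponent_succ_mul hℓ]
      ring
    rw [this]
    exact hI i hi (j + 1)
  have hcF : ∀ j, homogeneousComponent j F = if j = m then F else 0 := fun j =>
    homogeneousComponent_of_mem hF
  have hlow : ∀ j, j < m → homogeneousComponent j H ∈ I := by
    intro j
    induction j with
    | zero =>
      intro h0
      simpa [hcF, h0.ne] using hc0
    | succ j ih =>
      intro hj
      have h1 := hcs j
      rw [hcF, if_neg hj.ne, zero_add] at h1
      simpa using add_mem h1 (Ideal.mul_mem_left _ ℓ (ih (by omega)))
  have hm : F + homogeneousComponent m H ∈ I := by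
    cases m with
    | zero => simpa only [hcF, if_true] using hc0
    | succ m =>
      have h1 := hcs m
      rw [hcF, if_pos rfl] at h1
      simpa using add_mem h1 (Ideal.mul_mem_left _ ℓ (hlow m (by omega)))
  have hhigh : ∀ t, ℓ ^ t * F + homogeneousComponent (m + t) H ∈ I := by
    intro t
    induction t with
    | zero => simpa using hm
    | succ t ih =>
      have h1 := hcs (m + t)
      rw [hcF, if_neg (by omega), zero_add] at h1
      have h2 := add_mem h1 (Ideal.mul_mem_left _ ℓ ih)
      rw [← add_assoc m t 1]
      convert h2 using 1
      ring
  refine ⟨H.totalDegree + 1, ?_⟩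
  have := hhigh (H.totalDegree + 1)
  rwa [homogeneousComponent_eq_zero _ _ (by omega), add_zero] at this

theorem map_mulLeft_map_mk_homogeneousSubmodule_le (hℓ : ℓ.IsHomogeneous 1) (m : ℕ) :
    ((homogeneousSubmodule σ ℂ m).map (Ideal.Quotient.mkₐ ℂ I).toLinearMap).map
      (LinearMap.mulLeft ℂ (Ideal.Quotient.mk I ℓ)) ≤
    (homogeneousSubmodule σ ℂ (m + 1)).map (Ideal.Quotient.mkₐ ℂ I).toLinearMap := by
  rintro _ ⟨_, ⟨F, hF, rfl⟩, rfl⟩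
  exact ⟨ℓ * F, by rw [add_comm]; exact hℓ.mul hF, rfl⟩

variable [Finite σ]

/-- If `I + (ℓ)` contains a power of the irrelevant ideal, multiplication by the linear form `ℓ` is
bijective on the graded quotient by `I` in large degrees. -/
theorem exists_mul_bijective (hI : ∀ F ∈ I, ∀ m, homogeneousComponent m F ∈ I)
    (hℓ : ℓ.IsHomogeneous 1) {M : ℕ} (hM : idealOfVars σ ℂ ^ M ≤ I ⊔ Ideal.span {ℓ}) :
    ∃ m₀, ∀ m, m₀ ≤ m →
      (∀ F : MvPolynomial σ ℂ, F.IsHomogeneous (m + 1) →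
        ∃ H : MvPolynomial σ ℂ, H.IsHomogeneous m ∧ F - ℓ * H ∈ I) ∧
      ∀ F : MvPolynomial σ ℂ, F.IsHomogeneous m → ℓ * F ∈ I → F ∈ I := by
  have hsurj : ∀ m, M ≤ m → ∀ F : MvPolynomial σ ℂ, F.IsHomogeneous (m + 1) →
      ∃ H : MvPolynomial σ ℂ, H.IsHomogeneous m ∧ F - ℓ * H ∈ I := by
    intro m hm F hF
    have hFM : F ∈ idealOfVars σ ℂ ^ M := by
      rw [mem_pow_idealOfVars_iff']
      intro x hx
      exact hF.coeff_eq_zero (by omega)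
    obtain ⟨i, hi, y, hy, hiy⟩ := Submodule.mem_sup.1 (hM hFM)
    obtain ⟨H, rfl⟩ := Ideal.mem_span_singleton'.1 hy
    refine ⟨homogeneousComponent m H, homogeneousComponent_isHomogeneous _ _, ?_⟩
    have := hI i hi (m + 1)
    rwa [show i = F - ℓ * H by rw [← hiy]; ring, map_sub, homogeneousComponent_succ_mul hℓ,
      homogeneousComponent_eq_self hF] at this
  set V : ℕ → Submodule ℂ (MvPolynomial σ ℂ ⧸ I) := fun m =>
    (homogeneousSubmodule σ ℂ m).map (Ideal.Quotient.mkₐ ℂ I).toLinearMap with hV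
  set L := LinearMap.mulLeft ℂ (Ideal.Quotient.mk I ℓ) with hL
  have hfin : ∀ m, Module.Finite ℂ (V m) := fun m =>
    Module.Finite.iff_fg.2 ((homogeneousSubmodule_fg σ ℂ m).map _)
  have hVL : ∀ m, M ≤ m → (V m).map L = V (m + 1) := by
    intro m hm
    refine le_antisymm (map_mulLeft_map_mk_homogeneousSubmodule_le hℓ m) ?_
    rintro _ ⟨F, hF, rfl⟩
    obtain ⟨H, hH, hFH⟩ := hsurj m hm F hF
    refine ⟨_, ⟨H, hH, rfl⟩, ?_⟩
    exact ((Ideal.Quotient.eq (I := I)).2 hFH).symm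
  set E : ℕ → ℕ := fun t => Module.finrank ℂ (V (M + t)) with hE
  have hanti : Antitone E := antitone_nat_of_succ_le fun t => by
    change Module.finrank ℂ (V (M + t + 1)) ≤ Module.finrank ℂ (V (M + t))
    rw [← hVL (M + t) (by omega)]
    exact Submodule.finrank_map_le L (V (M + t))
  obtain ⟨T, hT⟩ : ∃ T, ∀ t, E T ≤ E t :=
    ⟨Function.argmin E, fun t => Function.argmin_le E t⟩
  refine ⟨M + T, fun m hm => ⟨hsurj m (by omega), fun F hF hℓF => ?_⟩⟩
  obtain ⟨t, rfl⟩ : ∃ t, m = M + t := ⟨m - M, by omega⟩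
  have heq : Module.finrank ℂ ((V (M + t)).map L) = Module.finrank ℂ (V (M + t)) := by
    rw [hVL _ (by omega)]
    have h1 := hT (t + 1)
    have h2 := hanti (show T ≤ t by omega)
    have h3 := hanti (show t ≤ t + 1 by omega)
    exact le_antisymm h3 (h2.trans h1)
  have hker : LinearMap.ker (L.domRestrict (V (M + t))) = ⊥ := by
    have h1 := (L.domRestrict (V (M + t))).finrank_range_add_finrank_ker
    rw [LinearMap.range_domRestrict, heq] at h1
    exact Submodule.finrank_eq_zero.1 (by omega)
  have h1 : (⟨Ideal.Quotient.mk I F, F, hF, rfl⟩ : V (M + t)) ∈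
      LinearMap.ker (L.domRestrict (V (M + t))) := by
    rw [LinearMap.mem_ker]
    exact (Ideal.Quotient.eq_zero_iff_mem (I := I)).2 hℓF
  rw [hker, Submodule.mem_bot] at h1
  exact Ideal.Quotient.eq_zero_iff_mem.1 (congrArg Subtype.val h1)

/-- In large degrees the pieces of the graded quotient by `I` are isomorphic to the quotient by
`I + (ℓ - 1)`. -/
theorem exists_rank_map_mk_homogeneousSubmodule
    (hI : ∀ F ∈ I, ∀ m, homogeneousComponent m F ∈ I)
    (hℓ : ℓ.IsHomogeneous 1) {M : ℕ} (hM : idealOfVars σ ℂ ^ M ≤ I ⊔ Ideal.span {ℓ}) :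
    ∃ m₀, ∀ m, m₀ ≤ m →
      Module.rank ℂ ((homogeneousSubmodule σ ℂ m).map (Ideal.Quotient.mkₐ ℂ I).toLinearMap) =
        Module.rank ℂ (MvPolynomial σ ℂ ⧸ (I ⊔ Ideal.span {ℓ - 1})) := by
  obtain ⟨m₀, hm₀⟩ := exists_mul_bijective hI hℓ hM
  refine ⟨m₀, fun m hm => ?_⟩
  set K := I ⊔ Ideal.span {ℓ - 1} with hK
  have hIK : I ≤ K := le_sup_left
  have hℓK : ℓ - 1 ∈ K := Ideal.mem_sup_right (Ideal.mem_span_singleton_self _)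
  have hpow : ∀ (t j : ℕ) (F : MvPolynomial σ ℂ), m₀ ≤ j → F.IsHomogeneous j →
      ℓ ^ t * F ∈ I → F ∈ I := by
    intro t
    induction t with
    | zero => intro j F _ _ h; simpa using h
    | succ t ih =>
      intro j F hj hF h
      refine (hm₀ j hj).2 F hF (ih (1 + j) (ℓ * F) (by omega) (hℓ.mul hF) ?_)
      rwa [← mul_assoc, ← pow_succ]
  have hlift : ∀ (j : ℕ) (F : MvPolynomial σ ℂ), F.IsHomogeneous j →
      ∃ H : MvPolynomial σ ℂ, H.IsHomogeneous m ∧ H - F ∈ K := by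
    intro j
    induction j using Nat.strong_induction_on with
    | _ j ih =>
      intro F hF
      rcases le_or_gt j m with hj | hj
      · refine ⟨ℓ ^ (m - j) * F, ?_, ?_⟩
        · have := (hℓ.pow (m - j)).mul hF
          rwa [one_mul, Nat.sub_add_cancel hj] at this
        · have h1 : ℓ ^ (m - j) - 1 ^ (m - j) ∈ K :=
            Ideal.mem_of_dvd _ (sub_dvd_pow_sub_pow ℓ 1 (m - j)) hℓK
          have h2 := Ideal.mul_mem_right F _ h1
          rwa [one_pow, sub_mul, one_mul] at h2
      · obtain ⟨j, rfl⟩ : ∃ i, j = i + 1 := ⟨j - 1, by omega⟩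
        obtain ⟨G, hG, hFG⟩ := (hm₀ j (by omega)).1 F hF
        obtain ⟨H, hH, hHG⟩ := ih j (by omega) G hG
        refine ⟨H, hH, ?_⟩
        have h1 := sub_mem (sub_mem hHG (Ideal.mul_mem_left _ G hℓK)) (hIK hFG)
        convert h1 using 1
        ring
  set V := (homogeneousSubmodule σ ℂ m).map (Ideal.Quotient.mkₐ ℂ I).toLinearMap with hV
  let θ : V →ₗ[ℂ] (MvPolynomial σ ℂ ⧸ K) :=
    (Ideal.Quotient.factorₐ ℂ hIK).toLinearMap.domRestrict V
  have hθ : Function.Bijective θ := by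
    constructor
    · rw [← LinearMap.ker_eq_bot, Submodule.eq_bot_iff]
      rintro ⟨_, F, hF, rfl⟩ h
      have hFK : F ∈ K := Ideal.Quotient.eq_zero_iff_mem.1 h
      obtain ⟨t, ht⟩ := exists_pow_mul_mem_of_mem_sup hI hℓ hF hFK
      exact Subtype.ext (Ideal.Quotient.eq_zero_iff_mem.2 (hpow t m F hm hF ht))
    · rw [← LinearMap.range_eq_top, eq_top_iff]
      rintro x -
      obtain ⟨F, rfl⟩ := Ideal.Quotient.mk_surjective x
      rw [← sum_homogeneousComponent F, map_sum]
      refine Submodule.sum_mem _ fun j _ => ?_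
      obtain ⟨H, hH, hHF⟩ := hlift j _ (homogeneousComponent_isHomogeneous j F)
      exact ⟨⟨_, H, hH, rfl⟩, (Ideal.Quotient.eq (I := K)).2 hHF⟩
  exact (LinearEquiv.ofBijective θ hθ).rank_eq

end Dehomogenization

/-! ### Homogeneity of the Hessian ideals -/

section Homogeneity

open MvPolynomial

attribute [local instance] MvPolynomial.gradedAlgebra

variable {n : ℕ}

theorem homogeneousComponent_mem_hessianIdeal {d : ℕ} {f : MvPolynomial (Fin (n + 1)) ℂ}
    (hf : f.IsHomogeneous d) (k : ℕ) {F : MvPolynomial (Fin (n + 1)) ℂ}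
    (hF : F ∈ jacobianIdeal f ⊔ minorsIdeal k (hessianMatrix f)) (m : ℕ) :
    homogeneousComponent m F ∈ jacobianIdeal f ⊔ minorsIdeal k (hessianMatrix f) := by
  refine homogeneousComponent_mem_of_mem (Ideal.IsHomogeneous.sup ?_ ?_) hF m
  · refine Ideal.homogeneous_span _ _ ?_
    rintro _ ⟨i, rfl⟩
    exact ⟨d - 1, hf.pderiv⟩
  · refine Ideal.homogeneous_span _ _ ?_
    rintro _ ⟨r, c, rfl⟩
    refine ⟨∑ _i : Fin k, (d - 1 - 1), ?_⟩
    rw [Matrix.det_apply]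
    refine IsHomogeneous.sum _ _ _ fun s _ => ?_
    have : (∏ i, (hessianMatrix f).submatrix r c (s i) i).IsHomogeneous
        (∑ _i : Fin k, (d - 1 - 1)) :=
      IsHomogeneous.prod _ _ _ fun i _ => hf.pderiv.pderiv
    rcases Int.units_eq_one_or (Equiv.Perm.sign s) with h | h
    · simpa [h] using this
    · simpa [h] using this.neg

end Homogeneity

noncomputable section

/-! ### Analytic germs -/

section Hadamard

/-- Hadamard's lemma for analytic functions. -/
theorem AnalyticAt.exists_eq_add_clm_apply {E : Type*} [NormedAddCommGroup E] [NormedSpace ℂ E]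
    {F : E → ℂ} (hF : AnalyticAt ℂ F 0) :
    ∃ G : E → E →L[ℂ] ℂ, AnalyticAt ℂ G 0 ∧ ∀ᶠ y in 𝓝 0, F y = F 0 + G y y := by
  obtain ⟨p, r, hp⟩ := hF
  have hpos : 0 < p.shift.radius := by
    rw [FormalMultilinearSeries.radius_shift]
    exact hp.r_pos.trans_le hp.r_le
  have hq := p.shift.hasFPowerSeriesOnBall hpos
  refine ⟨p.shift.sum, hq.analyticAt, ?_⟩
  have hr : 0 < min r p.shift.radius := lt_min hp.r_pos hpos
  filter_upwards [Metric.eball_mem_nhds (0 : E) hr] with y hy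
  have h1 := hp.hasSum (Metric.eball_subset_eball (min_le_left _ _) hy)
  have h2 := (hq.hasSum (Metric.eball_subset_eball (min_le_right _ _) hy)).mapL
    (ContinuousLinearMap.apply ℂ ℂ y)
  rw [zero_add] at h1 h2
  have h3 : ∀ m, (ContinuousLinearMap.apply ℂ ℂ y) (p.shift m fun _ => y) =
      p (m + 1) fun _ => y := fun m => by
    simp only [FormalMultilinearSeries.shift, ContinuousLinearMap.apply_apply]
    rw [ContinuousMultilinearMap.curryRight_apply]
    congr 1
    ext i
    refine Fin.lastCases ?_ (fun i => ?_) i <;> simp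
  simp only [h3] at h2
  have h4 := (hasSum_nat_add_iff' 1).2 h1
  have h5 := h2.unique h4
  simp only [Finset.range_one, Finset.sum_singleton] at h5
  rw [hp.coeff_zero] at h5
  rw [ContinuousLinearMap.apply_apply] at h5
  rw [h5]
  ring

end Hadamard

namespace analyticGerms

variable {n : ℕ}

/-- The germ at the origin of an analytic function. -/
def of (F : (Fin n → ℂ) → ℂ) (hF : AnalyticAt ℂ F 0) : analyticGerms n :=
  ⟨Germ.ofFun F, F, hF, rfl⟩

theorem exists_eq_of (g : analyticGerms n) : ∃ F hF, g = of F hF := by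
  obtain ⟨_, F, hF, rfl⟩ := g
  exact ⟨F, hF, rfl⟩

/-- The derivation `∂/∂y_i` of the ring of analytic germs. -/
def partialDerivation (i : Fin n) : Derivation ℂ (analyticGerms n) (analyticGerms n) :=
  Derivation.mk'
    { toFun := analyticGerms.partial i
      map_add' := by
        intro g h
        obtain ⟨F, hF, rfl⟩ := exists_eq_of g
        obtain ⟨G, hG, rfl⟩ := exists_eq_of h
        refine Subtype.ext (Germ.coe_eq.2 ?_)
        filter_upwards [hF.eventually_analyticAt, hG.eventually_analyticAt] with y hy hy'
        exact DFunLike.congr_fun (fderiv_add hy.differentiableAt hy'.differentiableAt) _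
      map_smul' := by
        intro c g
        obtain ⟨F, hF, rfl⟩ := exists_eq_of g
        refine Subtype.ext (Germ.coe_eq.2 ?_)
        filter_upwards [hF.eventually_analyticAt] with y hy
        exact DFunLike.congr_fun (fderiv_const_smul hy.differentiableAt c) _ }
    (by
      intro g h
      obtain ⟨F, hF, rfl⟩ := exists_eq_of g
      obtain ⟨G, hG, rfl⟩ := exists_eq_of h
      refine Subtype.ext (Germ.coe_eq.2 ?_)
      filter_upwards [hF.eventually_analyticAt, hG.eventually_analyticAt] with y hy hy'
      exact DFunLike.congr_fun (fderiv_mul hy.differentiableAt hy'.differentiableAt) _)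

/-- The value of an analytic germ at the origin. -/
def valueAtZero (n : ℕ) : analyticGerms n →ₐ[ℂ] ℂ :=
  { Germ.valueRingHom.comp (analyticGerms n).toSubring.subtype with
    commutes' := fun r => by
      have : (algebraMap ℂ (Germ (𝓝 (0 : Fin n → ℂ)) ℂ) r) = r • 1 :=
        Algebra.algebraMap_eq_smul_one r
      change Germ.value (algebraMap ℂ (Germ (𝓝 (0 : Fin n → ℂ)) ℂ) r) = r
      rw [this]
      exact mul_one r }

@[simp]
theorem valueAtZero_of (F : (Fin n → ℂ) → ℂ) (hF : AnalyticAt ℂ F 0) :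
    valueAtZero n (of F hF) = F 0 := rfl

theorem valueAtZero_partialDerivation_of (i : Fin n) (F : (Fin n → ℂ) → ℂ)
    (hF : AnalyticAt ℂ F 0) :
    valueAtZero n (partialDerivation i (of F hF)) = fderiv ℂ F 0 (Pi.single i 1) := rfl

theorem isUnit_of_valueAtZero_ne_zero {g : analyticGerms n} (hg : valueAtZero n g ≠ 0) :
    IsUnit g := by
  obtain ⟨F, hF, rfl⟩ := exists_eq_of g
  rw [valueAtZero_of] at hg
  refine IsUnit.of_mul_eq_one (of _ (hF.inv hg)) (Subtype.ext (Germ.coe_eq.2 ?_))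
  filter_upwards [hF.continuousAt.eventually_ne hg] with y hy
  exact mul_inv_cancel₀ hy

/-- The maximal ideal of the ring of analytic germs. -/
def maximalIdeal (n : ℕ) : Ideal (analyticGerms n) := RingHom.ker (valueAtZero n)

theorem mem_maximalIdeal {g : analyticGerms n} : g ∈ maximalIdeal n ↔ valueAtZero n g = 0 :=
  Iff.rfl

theorem maximalIdeal_le_jacobson_bot : maximalIdeal n ≤ (⊥ : Ideal (analyticGerms n)).jacobson :=
  fun g hg => Ideal.mem_jacobson_bot.2 fun h => isUnit_of_valueAtZero_ne_zero (by
    rw [map_add, map_mul, mem_maximalIdeal.1 hg, zero_mul, zero_add, map_one]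
    exact one_ne_zero)

theorem isUnit_matrix_of_det_ne_zero {N : ℕ} (M : Matrix (Fin N) (Fin N) (analyticGerms n))
    (hM : (M.map (valueAtZero n)).det ≠ 0) : IsUnit M := by
  rw [Matrix.isUnit_iff_isUnit_det]
  apply isUnit_of_valueAtZero_ne_zero
  rw [AlgHom.map_det]
  exact hM

theorem analyticAt_coord (i : Fin n) : AnalyticAt ℂ (fun y : Fin n → ℂ => y i) 0 :=
  (ContinuousLinearMap.proj (R := ℂ) (φ := fun _ : Fin n => ℂ) i).analyticAt 0

/-- The germ of the `i`-th coordinate function. -/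
def coord (i : Fin n) : analyticGerms n :=
  of (fun y => y i) (analyticAt_coord i)

theorem coord_mem_maximalIdeal (i : Fin n) : coord i ∈ maximalIdeal n := by
  rw [mem_maximalIdeal]; rfl

theorem exists_eq_sum_mul_coord {g : analyticGerms n} (hg : g ∈ maximalIdeal n) :
    ∃ G : Fin n → analyticGerms n, g = ∑ i, G i * coord i := by
  obtain ⟨F, hF, rfl⟩ := exists_eq_of g
  obtain ⟨G, hG, h⟩ := hF.exists_eq_add_clm_apply
  have hF0 : F 0 = 0 := hg
  have hGi : ∀ i : Fin n, AnalyticAt ℂ (fun y => G y (Pi.single i 1)) 0 := fun i =>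
    ((ContinuousLinearMap.apply ℂ ℂ (Pi.single i 1 : Fin n → ℂ)).analyticAt _).comp hG
  refine ⟨fun i => of _ (hGi i), Subtype.ext ?_⟩
  have h1 : ((∑ i, of _ (hGi i) * coord i : analyticGerms n) : Germ (𝓝 (0 : Fin n → ℂ)) ℂ) =
      Germ.ofFun (∑ i, fun y : Fin n → ℂ => G y (Pi.single i 1) * y i) := by
    rw [AddSubmonoidClass.coe_finsetSum]
    exact (map_sum (Germ.coeAddHom (M := ℂ) (𝓝 (0 : Fin n → ℂ)))
      (fun i => fun y : Fin n → ℂ => G y (Pi.single i 1) * y i) Finset.univ).symm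
  rw [h1]
  refine Germ.coe_eq.2 ?_
  filter_upwards [h] with y hy
  rw [hy, hF0, zero_add, Finset.sum_apply]
  calc G y y = G y (∑ i, y i • Pi.single i 1) := congrArg (G y) (pi_eq_sum_univ' y)
    _ = ∑ i, G y (Pi.single i 1) * y i := by
      rw [map_sum]
      exact Finset.sum_congr rfl fun i _ => by rw [map_smul, smul_eq_mul, mul_comm]

theorem maximalIdeal_eq_span : maximalIdeal n = Ideal.span (Set.range coord) := by
  refine le_antisymm (fun g hg => ?_) (Ideal.span_le.2 ?_)
  · obtain ⟨G, rfl⟩ := exists_eq_sum_mul_coord hg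
    exact Ideal.sum_mem _ fun i _ => Ideal.mul_mem_left _ _ (Ideal.subset_span ⟨i, rfl⟩)
  · rintro _ ⟨i, rfl⟩
    exact coord_mem_maximalIdeal i

theorem maximalIdeal_fg : (maximalIdeal n).FG := by
  rw [maximalIdeal_eq_span]
  exact Submodule.fg_span (Set.finite_range _)

theorem valueAtZero_partialDerivation_coord (i j : Fin n) :
    valueAtZero n (partialDerivation i (coord j)) = if j = i then 1 else 0 := by
  have h : fderiv ℂ (fun y : Fin n → ℂ => y j) 0 =
      ContinuousLinearMap.proj (R := ℂ) (φ := fun _ : Fin n => ℂ) j :=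
    (ContinuousLinearMap.proj (R := ℂ) (φ := fun _ : Fin n => ℂ) j).fderiv
  rw [coord, valueAtZero_partialDerivation_of, h]
  simp [Pi.single_apply]

theorem mem_maximalIdeal_sq {g : analyticGerms n} (hg : g ∈ maximalIdeal n)
    (hd : ∀ i, valueAtZero n (partialDerivation i g) = 0) : g ∈ maximalIdeal n ^ 2 := by
  obtain ⟨G, rfl⟩ := exists_eq_sum_mul_coord hg
  rw [pow_two]
  refine Ideal.sum_mem _ fun i _ => Ideal.mul_mem_mul ?_ (coord_mem_maximalIdeal i)
  have := hd i
  have h0 : ∀ j : Fin n, valueAtZero n (coord j) = 0 := fun j => coord_mem_maximalIdeal j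
  simpa [Derivation.leibniz, h0, valueAtZero_partialDerivation_coord, mem_maximalIdeal] using this

theorem isBigO_of_mem_maximalIdeal_pow (s : ℕ) {F : (Fin n → ℂ) → ℂ} {hF : AnalyticAt ℂ F 0}
    (h : of F hF ∈ maximalIdeal n ^ s) : F =O[𝓝 0] fun y => ‖y‖ ^ s := by
  let B : ∀ s : ℕ, Ideal (analyticGerms n) := fun s =>
    { carrier := {g | ∀ F hF, g = of F hF → F =O[𝓝 0] fun y => ‖y‖ ^ s}
      zero_mem' := by
        intro F hF h
        have : F =ᶠ[𝓝 0] 0 := (Germ.coe_eq.1 (congrArg Subtype.val h)).symm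
        exact this.trans_isBigO (Asymptotics.isBigO_zero _ _)
      add_mem' := by
        intro a b ha hb F hF h
        obtain ⟨A, hA, rfl⟩ := exists_eq_of a
        obtain ⟨C, hC, rfl⟩ := exists_eq_of b
        have : F =ᶠ[𝓝 0] A + C := (Germ.coe_eq.1 (congrArg Subtype.val h)).symm
        exact this.trans_isBigO ((ha _ _ rfl).add (hb _ _ rfl))
      smul_mem' := by
        intro c a ha F hF h
        obtain ⟨A, hA, rfl⟩ := exists_eq_of a
        obtain ⟨C, hC, rfl⟩ := exists_eq_of c
        have : F =ᶠ[𝓝 0] C * A := (Germ.coe_eq.1 (congrArg Subtype.val h)).symm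
        have h1 : C =O[𝓝 0] fun _ => (1 : ℝ) := hC.continuousAt.isBigO_one ℝ
        simpa using this.trans_isBigO (h1.mul (ha _ _ rfl)) }
  suffices hle : ∀ s, maximalIdeal n ^ s ≤ B s from hle s h F hF rfl
  intro s
  induction s with
  | zero =>
    intro g _ F hF _
    simpa using hF.continuousAt.isBigO_one ℝ
  | succ s ih =>
    rw [pow_succ, Ideal.mul_le]
    intro a ha b hb F hF h
    obtain ⟨A, hA, rfl⟩ := exists_eq_of a
    obtain ⟨C, hC, rfl⟩ := exists_eq_of b
    have : F =ᶠ[𝓝 0] A * C := (Germ.coe_eq.1 (congrArg Subtype.val h)).symm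
    have hC0 : C 0 = 0 := hb
    have h1 : C =O[𝓝 0] fun y => ‖y‖ := by
      have := hC.differentiableAt.isBigO_sub
      simpa [hC0] using this.norm_right
    simpa [pow_succ] using this.trans_isBigO ((ih ha _ _ rfl).mul h1)

end analyticGerms

end

noncomputable section

/-! ### The ideal of a point of affine space -/

section PointIdeal

open MvPolynomial

variable {σ : Type*}

/-- The ideal generated by the polynomials `X_i - b_i`. -/
def pointIdeal (b : σ → ℂ) : Ideal (MvPolynomial σ ℂ) :=
  Ideal.span (Set.range fun i => X i - C (b i))

theorem eval_aeval_eq {τ : Type*} (x : τ → ℂ) (v : σ → MvPolynomial τ ℂ) (P : MvPolynomial σ ℂ) :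
    eval x (aeval v P) = eval (fun i => eval x (v i)) P := by
  induction P using MvPolynomial.induction_on with
  | C a => simp
  | add p q hp hq => rw [map_add, map_add, map_add, hp, hq]
  | mul_X p i hp => rw [map_mul, map_mul, map_mul, hp, aeval_X, eval_X]

theorem MvPolynomial.IsHomogeneous.eval_const_mul {r : ℕ} {P : MvPolynomial σ ℂ}
    (hP : P.IsHomogeneous r) (t : ℂ) (x : σ → ℂ) :
    eval (fun i => t * x i) P = t ^ r * eval x P := by
  rw [eval_eq, eval_eq, Finset.mul_sum]
  refine Finset.sum_congr rfl fun d hd => ?_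
  rw [hP.degree_eq_sum_deg_support hd, ← Finset.prod_pow_eq_pow_sum]
  simp only [mul_pow, Finset.prod_mul_distrib]
  ring

theorem aeval_sub_aeval_mem {A : Type*} [CommRing A] [Algebra ℂ A] {J : Ideal A} {x y : σ → A}
    (h : ∀ i, x i - y i ∈ J) (F : MvPolynomial σ ℂ) : aeval x F - aeval y F ∈ J := by
  have : (Ideal.Quotient.mkₐ ℂ J).comp (aeval x) = (Ideal.Quotient.mkₐ ℂ J).comp (aeval y) := by
    ext i
    simpa using Ideal.Quotient.eq.2 (h i)
  exact Ideal.Quotient.eq.1 (DFunLike.congr_fun this F)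

theorem sub_C_eval_mem_pointIdeal (b : σ → ℂ) (F : MvPolynomial σ ℂ) :
    F - C (eval b F) ∈ pointIdeal b := by
  have h := aeval_sub_aeval_mem (J := pointIdeal b) (x := X) (y := fun i => C (b i))
    (fun i => Ideal.subset_span ⟨i, rfl⟩) F
  have h2 : aeval (fun i => (C (b i) : MvPolynomial σ ℂ)) F = C (eval b F) :=
    aeval_algebraMap_apply (A := ℂ) (B := MvPolynomial σ ℂ) b F
  rwa [aeval_X_left_apply, h2] at h

theorem mem_pointIdeal_iff {b : σ → ℂ} {F : MvPolynomial σ ℂ} :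
    F ∈ pointIdeal b ↔ eval b F = 0 := by
  constructor
  · intro h
    have : pointIdeal b ≤ RingHom.ker (eval b) := by
      rw [pointIdeal, Ideal.span_le]
      rintro _ ⟨i, rfl⟩
      simp
    exact this h
  · intro h
    simpa [h] using sub_C_eval_mem_pointIdeal b F

theorem eval_mem_pow_succ_of_coeff_mem {A : Type*} [CommRing A] {J : Ideal A} {x : σ → A}
    (hx : ∀ i, x i ∈ J) {r : ℕ} {q : MvPolynomial σ A} (hq : q.IsHomogeneous r)
    (hc : ∀ d, coeff d q ∈ J) : eval x q ∈ J ^ (r + 1) := by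
  rw [eval_eq]
  refine Ideal.sum_mem _ fun d hd => ?_
  rw [pow_succ']
  refine Ideal.mul_mem_mul (hc d) ?_
  rw [hq.degree_eq_sum_deg_support hd, ← Finset.prod_pow_eq_pow_sum]
  exact Ideal.prod_mem_prod fun i _ => Ideal.pow_mem_pow (hx i) _

/-- An element of the `r`-th power of the ideal of `b` has a leading form at `b`. -/
theorem exists_isHomogeneous_sub_mem_pointIdeal_pow {b : σ → ℂ} {r : ℕ} {F : MvPolynomial σ ℂ}
    (hF : F ∈ pointIdeal b ^ r) : ∃ P : MvPolynomial σ ℂ, P.IsHomogeneous r ∧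
      F - aeval (fun i => X i - C (b i)) P ∈ pointIdeal b ^ (r + 1) := by
  obtain ⟨p, hp, rfl⟩ := (Ideal.mem_span_pow_iff_exists_isHomogeneous _ _).1 hF
  refine ⟨p.map (eval b), hp.map _, ?_⟩
  have h1 : aeval (fun i => (X i - C (b i) : MvPolynomial σ ℂ)) (p.map (eval b)) =
      eval (fun i => X i - C (b i)) ((p.map (eval b)).map C) := by
    rw [eval_map, aeval_def, MvPolynomial.algebraMap_eq]
  rw [h1, ← map_sub]
  refine eval_mem_pow_succ_of_coeff_mem (fun i => Ideal.subset_span (Set.mem_range_self i))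
    (hp.sub ((hp.map _).map _)) fun d => ?_
  rw [coeff_sub, coeff_map, coeff_map]
  exact sub_C_eval_mem_pointIdeal b _

end PointIdeal

/-! ### Comparison of a point of a hyperplane with a germ of an immersion -/

section Comparison

open MvPolynomial analyticGerms

theorem exists_mem_sub_mem_mul_map {A B F : Type*} [CommRing A] [CommRing B] [FunLike F A B]
    [RingHomClass F A B] (ψ : F)
    (𝔞 : Ideal A) (𝔟 : Ideal B) (h : ∀ y, ∃ x, y - ψ x ∈ 𝔟) {y : B} (hy : y ∈ 𝔞.map ψ) :
    ∃ x ∈ 𝔞, y - ψ x ∈ 𝔟 * 𝔞.map ψ := by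
  induction hy using Submodule.span_induction with
  | mem y hy =>
    obtain ⟨x, hx, rfl⟩ := hy
    exact ⟨x, hx, by simp⟩
  | zero => exact ⟨0, zero_mem _, by simp⟩
  | add y z _ _ hy hz =>
    obtain ⟨x, hx, hxy⟩ := hy
    obtain ⟨x', hx', hxz⟩ := hz
    refine ⟨x + x', add_mem hx hx', ?_⟩
    rw [map_add, add_sub_add_comm]
    exact add_mem hxy hxz
  | smul c y hy ih =>
    obtain ⟨x, hx, hxy⟩ := ih
    obtain ⟨c', hc⟩ := h c
    refine ⟨c' * x, Ideal.mul_mem_left _ _ hx, ?_⟩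
    rw [smul_eq_mul, map_mul, show c * y - ψ c' * ψ x = (c - ψ c') * y + ψ c' * (y - ψ x) by ring]
    exact add_mem (Ideal.mul_mem_mul hc hy) (Ideal.mul_mem_left _ (ψ c') hxy)

theorem rank_quotient_map {A B : Type} [CommRing A] [CommRing B] [Algebra ℂ A] [Algebra ℂ B]
    (ψ : A →ₐ[ℂ] B) {I L : Ideal A} {𝔟 : Ideal B} (hsurj : ∀ y, ∃ x, y - ψ x ∈ 𝔟)
    (hle : 𝔟 ≤ I.map ψ) (hL : L.map ψ ≤ 𝔟) (hmem : ∀ x, ψ x ∈ 𝔟 → x ∈ L) :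
    Module.rank ℂ (B ⧸ I.map ψ) = Module.rank ℂ (A ⧸ (I ⊔ L)) := by
  let θ : A →ₐ[ℂ] (B ⧸ I.map ψ) := (Ideal.Quotient.mkₐ ℂ (I.map ψ)).comp ψ
  have hθ : Function.Surjective θ := by
    intro x
    obtain ⟨u, rfl⟩ := Ideal.Quotient.mk_surjective x
    obtain ⟨v, hv⟩ := hsurj u
    exact ⟨v, (Ideal.Quotient.eq.2 (hle hv)).symm⟩
  have hker : RingHom.ker θ = I ⊔ L := by
    refine le_antisymm (fun F hF => ?_) (sup_le ?_ ?_)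
    · have hF' : ψ F ∈ I.map ψ := Ideal.Quotient.eq_zero_iff_mem.1 hF
      obtain ⟨v, hv, hFv⟩ := exists_mem_sub_mem_mul_map ψ I 𝔟 hsurj hF'
      have h1 : ψ (F - v) ∈ 𝔟 := by
        rw [map_sub]
        exact (Ideal.mul_le_inf (I := 𝔟) (J := I.map ψ) hFv).1
      rw [← add_sub_cancel v F]
      exact add_mem (Ideal.mem_sup_left hv) (Ideal.mem_sup_right (hmem _ h1))
    · exact fun F hF => Ideal.Quotient.eq_zero_iff_mem.2 (Ideal.mem_map_of_mem ψ hF)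
    · exact fun F hF => Ideal.Quotient.eq_zero_iff_mem.2 (hle (hL (Ideal.mem_map_of_mem ψ hF)))
  rw [← hker]
  exact (Ideal.quotientKerAlgEquivOfSurjective hθ).toLinearEquiv.rank_eq.symm

variable {n : ℕ} {Φ : Fin (n + 1) → analyticGerms n} {b : Fin (n + 1) → ℂ}

theorem coe_aeval_eq {φ : (Fin n → ℂ) → Fin (n + 1) → ℂ}
    (hφ : ∀ i, (Φ i : Germ (𝓝 (0 : Fin n → ℂ)) ℂ) = Germ.ofFun fun y => φ y i)
    (P : MvPolynomial (Fin (n + 1)) ℂ) :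
    ((aeval Φ P : analyticGerms n) : Germ (𝓝 (0 : Fin n → ℂ)) ℂ) =
      Germ.ofFun fun y => eval (φ y) P := by
  induction P using MvPolynomial.induction_on with
  | C a =>
    rw [← MvPolynomial.algebraMap_eq, AlgHom.commutes, Algebra.algebraMap_eq_smul_one]
    refine Germ.coe_eq.2 (Eventually.of_forall fun y => ?_)
    simp
  | add p q hp hq =>
    simp only [map_add, Subalgebra.coe_add, hp, hq]
    rfl
  | mul_X p i hp =>
    simp only [map_mul, Subalgebra.coe_mul, hp, aeval_X, hφ, eval_X]
    rfl

theorem exists_sub_mem_maximalIdeal (Φ : Fin (n + 1) → analyticGerms n) (u : analyticGerms n) :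
    ∃ v : MvPolynomial (Fin (n + 1)) ℂ, u - aeval Φ v ∈ maximalIdeal n :=
  ⟨C (valueAtZero n u), by
    rw [mem_maximalIdeal, map_sub, ← MvPolynomial.algebraMap_eq, AlgHom.commutes,
      AlgHom.commutes]
    exact sub_self _⟩

theorem map_pointIdeal_le (hb : ∀ i, valueAtZero n (Φ i) = b i) :
    (pointIdeal b).map (aeval Φ : _ →ₐ[ℂ] analyticGerms n) ≤ maximalIdeal n := by
  rw [pointIdeal, Ideal.map_span, Ideal.span_le]
  rintro _ ⟨_, ⟨i, rfl⟩, rfl⟩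
  rw [SetLike.mem_coe, mem_maximalIdeal, map_sub, map_sub, aeval_X, hb,
    ← MvPolynomial.algebraMap_eq, AlgHom.commutes, AlgHom.commutes]
  exact sub_self _

theorem map_pointIdeal (hb : ∀ i, valueAtZero n (Φ i) = b i)
    (hΦ : IsUnit (frameMatrix partialDerivation Φ)) :
    (pointIdeal b).map (aeval Φ : _ →ₐ[ℂ] analyticGerms n) = maximalIdeal n := by
  refine le_antisymm (map_pointIdeal_le hb) ?_
  refine Submodule.le_of_le_smul_of_le_jacobson_bot maximalIdeal_fg
    maximalIdeal_le_jacobson_bot ?_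
  obtain ⟨Q, hQ⟩ := hΦ.exists_left_inv
  conv_lhs => rw [maximalIdeal_eq_span]
  rw [Ideal.span_le]
  rintro _ ⟨i, rfl⟩
  set w : analyticGerms n := ∑ j, algebraMap ℂ _ (valueAtZero n (Q i.succ j)) *
    aeval Φ (X j - C (b j)) with hw
  have hw1 : w ∈ (pointIdeal b).map (aeval Φ : _ →ₐ[ℂ] analyticGerms n) :=
    Ideal.sum_mem _ fun j _ => Ideal.mul_mem_left _ _
      (Ideal.mem_map_of_mem _ (Ideal.subset_span ⟨j, rfl⟩))
  have hw2 : coord i - w ∈ maximalIdeal n ^ 2 := by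
    refine mem_maximalIdeal_sq (sub_mem (coord_mem_maximalIdeal i) (map_pointIdeal_le hb hw1))
      fun l => ?_
    have h1 := congrArg (valueAtZero n) (congrFun (congrFun hQ i.succ) l.succ)
    rw [Matrix.mul_apply, map_sum] at h1
    have h2 : valueAtZero n (partialDerivation l w) =
        ∑ j, valueAtZero n (Q i.succ j * frameMatrix partialDerivation Φ j l.succ) := by
      rw [hw, map_sum, map_sum]
      refine Finset.sum_congr rfl fun j _ => ?_
      rw [Derivation.leibniz, Derivation.map_algebraMap, smul_zero, add_zero, smul_eq_mul, map_mul,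
        AlgHom.commutes, map_mul, map_sub, map_sub, aeval_X, ← MvPolynomial.algebraMap_eq,
        AlgHom.commutes, Derivation.map_algebraMap, sub_zero]
      rfl
    rw [map_sub, map_sub, h2, h1, valueAtZero_partialDerivation_coord, Matrix.one_apply]
    simp only [Fin.succ_inj]
    split_ifs <;> simp
  rw [SetLike.mem_coe, show coord i = w + (coord i - w) by ring]
  refine add_mem (Submodule.mem_sup_left hw1) (Submodule.mem_sup_right ?_)
  rwa [smul_eq_mul, ← pow_two]

theorem exists_sub_mem_maximalIdeal_pow (hb : ∀ i, valueAtZero n (Φ i) = b i)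
    (hΦ : IsUnit (frameMatrix partialDerivation Φ)) (N : ℕ) (u : analyticGerms n) :
    ∃ v : MvPolynomial (Fin (n + 1)) ℂ, u - aeval Φ v ∈ maximalIdeal n ^ N := by
  induction N with
  | zero => exact ⟨0, by simp⟩
  | succ N ih =>
    obtain ⟨v, hv⟩ := ih
    rw [← map_pointIdeal hb hΦ, ← Ideal.map_pow] at hv
    obtain ⟨x, -, hx⟩ := exists_mem_sub_mem_mul_map
      (aeval Φ : _ →ₐ[ℂ] analyticGerms n) _ (maximalIdeal n)
      (exists_sub_mem_maximalIdeal Φ) hv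
    refine ⟨v + x, ?_⟩
    rw [Ideal.map_pow, map_pointIdeal hb hΦ, ← pow_succ'] at hx
    rw [map_add, ← sub_sub]
    exact hx

/-- A form vanishing to higher order along the immersion `Φ` vanishes
on the image of its differential. -/
theorem eval_frame_eq_zero (hb : ∀ i, valueAtZero n (Φ i) = b i) {r : ℕ}
    {P : MvPolynomial (Fin (n + 1)) ℂ} (hP : P.IsHomogeneous r)
    (h : aeval Φ (aeval (fun i => X i - C (b i)) P) ∈ maximalIdeal n ^ (r + 1))
    (w : Fin n → ℂ) :
    eval (fun i => ∑ j, w j * valueAtZero n (partialDerivation j (Φ i))) P = 0 := by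
  choose φ hφ hΦ using fun i => exists_eq_of (Φ i)
  have hG : AnalyticAt ℂ (fun y => eval (fun i => φ i y - b i) P) 0 := by
    have := AnalyticAt.aeval_mvPolynomial (f := fun y i => φ i y - b i)
      (fun i => (hφ i).sub analyticAt_const) P
    simpa [aeval_eq_eval] using this
  have h1 : aeval Φ (aeval (fun i => X i - C (b i)) P) = of _ hG := by
    refine Subtype.ext ?_
    rw [coe_aeval_eq (φ := fun y i => φ i y) fun i => by rw [hΦ]; rfl]
    simp only [eval_aeval_eq, map_sub, eval_X, eval_C]
    rfl
  rw [h1] at h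
  have hO := isBigO_of_mem_maximalIdeal_pow _ h
  have hφ0 : ∀ i, φ i 0 = b i := fun i => by rw [← hb, hΦ]; rfl
  -- difference quotients along the line spanned by `w`
  have hlim : ∀ i, Tendsto (fun t : ℂ => t⁻¹ * (φ i (t • w) - b i)) (𝓝[≠] 0)
      (𝓝 (∑ j, w j * valueAtZero n (partialDerivation j (Φ i)))) := by
    intro i
    have hline : HasDerivAt (fun t : ℂ => t • w) w 0 := by
      simpa using (hasDerivAt_id (0 : ℂ)).smul_const w
    have hd : HasFDerivAt (φ i) (fderiv ℂ (φ i) 0) ((0 : ℂ) • w) := by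
      rw [zero_smul]
      exact (hφ i).differentiableAt.hasFDerivAt
    have h2 := (hd.comp_hasDerivAt (0 : ℂ) hline).tendsto_slope_zero
    have h3 : fderiv ℂ (φ i) 0 w = ∑ j, w j * valueAtZero n (partialDerivation j (Φ i)) := by
      calc fderiv ℂ (φ i) 0 w = fderiv ℂ (φ i) 0 (∑ j, w j • Pi.single j 1) :=
            congrArg _ (pi_eq_sum_univ' w)
        _ = _ := by
          rw [map_sum]
          refine Finset.sum_congr rfl fun j _ => ?_
          rw [map_smul, smul_eq_mul, hΦ, valueAtZero_partialDerivation_of]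
    rw [h3] at h2
    simpa [hφ0] using h2
  have hlim2 : Tendsto (fun t : ℂ => eval (fun i => t⁻¹ * (φ i (t • w) - b i)) P) (𝓝[≠] 0)
      (𝓝 (eval (fun i => ∑ j, w j * valueAtZero n (partialDerivation j (Φ i))) P)) :=
    ((MvPolynomial.continuous_eval P).tendsto _).comp (tendsto_pi_nhds.2 hlim)
  have hlim3 : Tendsto (fun t : ℂ => eval (fun i => t⁻¹ * (φ i (t • w) - b i)) P) (𝓝[≠] 0)
      (𝓝 0) := by
    have h4 : Tendsto (fun t : ℂ => t • w) (𝓝[≠] 0) (𝓝 0) := by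
      have : Tendsto (fun t : ℂ => t • w) (𝓝 0) (𝓝 ((0 : ℂ) • w)) :=
        (continuous_id.smul continuous_const).tendsto 0
      rw [zero_smul] at this
      exact this.mono_left nhdsWithin_le_nhds
    have h5 : (fun t : ℂ => eval (fun i => φ i (t • w) - b i) P) =O[𝓝[≠] 0]
        fun t => t ^ (r + 1) := by
      refine (hO.comp_tendsto h4).trans ?_
      refine Asymptotics.IsBigO.of_bound (‖w‖ ^ (r + 1)) (Eventually.of_forall fun t => ?_)
      simp [norm_smul, mul_pow, mul_comm]
    have h6 : (fun t : ℂ => (t⁻¹) ^ r * eval (fun i => φ i (t • w) - b i) P) =O[𝓝[≠] 0]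
        fun t : ℂ => t := by
      refine ((Asymptotics.isBigO_refl (fun t : ℂ => (t⁻¹) ^ r) _).mul h5).congr' EventuallyEq.rfl ?_
      filter_upwards [self_mem_nhdsWithin] with t ht
      have ht : t ≠ 0 := ht
      rw [inv_pow, pow_succ]
      field_simp
    have h7 := h6.trans_tendsto (tendsto_id.mono_left nhdsWithin_le_nhds)
    exact h7.congr fun t => (hP.eval_const_mul _ _).symm
  exact tendsto_nhds_unique hlim2 hlim3

/-- For an immersion `Φ` into the hyperplane `ℓ = 1`, with `ℓ = ∑ c_i x_i`, the polynomials whose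
pull-back vanishes to order `N` vanish to order `N` on the hyperplane. -/
theorem mem_of_aeval_mem_maximalIdeal_pow (hb : ∀ i, valueAtZero n (Φ i) = b i)
    (hΦ : IsUnit (frameMatrix partialDerivation Φ)) {c : Fin (n + 1) → ℂ}
    (hc : aeval Φ (∑ i, C (c i) * X i : MvPolynomial (Fin (n + 1)) ℂ) = 1) (N : ℕ)
    (F : MvPolynomial (Fin (n + 1)) ℂ) (hF : aeval Φ F ∈ maximalIdeal n ^ N) :
    F ∈ Ideal.span {∑ i, C (c i) * X i - 1} ⊔ pointIdeal b ^ N := by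
  set ℓ : MvPolynomial (Fin (n + 1)) ℂ := ∑ i, C (c i) * X i with hℓ
  induction N with
  | zero => simp
  | succ r ih =>
    obtain ⟨y, hy, F₁, hF₁, rfl⟩ := Submodule.mem_sup.1 (ih (Ideal.pow_le_pow_right (by omega) hF))
    obtain ⟨A, rfl⟩ := Ideal.mem_span_singleton'.1 hy
    obtain ⟨P, hP, hPF⟩ := exists_isHomogeneous_sub_mem_pointIdeal_pow hF₁
    set Q : MvPolynomial (Fin (n + 1)) ℂ := aeval (fun i => X i - C (b i)) P with hQ
    have h1 : aeval Φ (F₁ - Q) ∈ maximalIdeal n ^ (r + 1) := by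
      rw [← map_pointIdeal hb hΦ, ← Ideal.map_pow]
      exact Ideal.mem_map_of_mem _ hPF
    have h2 : aeval Φ Q ∈ maximalIdeal n ^ (r + 1) := by
      rw [map_add, map_mul, map_sub, hc, map_one, sub_self, mul_zero, zero_add] at hF
      have := sub_mem hF h1
      rwa [map_sub, sub_sub_cancel] at this
    have h3 := eval_frame_eq_zero hb hP h2
    -- the values of `ℓ` on the frame
    have hcb : ∑ i, c i * b i = 1 := by
      have := congrArg (valueAtZero n) hc
      simpa [hℓ, hb, ← MvPolynomial.algebraMap_eq] using this
    have hcL : ∀ j, ∑ i, c i * valueAtZero n (partialDerivation j (Φ i)) = 0 := fun j => by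
      have := congrArg (fun x => valueAtZero n (partialDerivation j x)) hc
      simpa [hℓ, ← MvPolynomial.algebraMap_eq, Derivation.leibniz] using this
    have h4 : aeval (fun i => X i - ℓ * C (b i)) P = 0 := by
      refine MvPolynomial.funext fun z => ?_
      obtain ⟨R, hR⟩ := hΦ.exists_right_inv
      set w : Fin (n + 1) → ℂ := Matrix.mulVec (R.map (valueAtZero n)) z with hw
      have hz : Matrix.mulVec ((frameMatrix partialDerivation Φ).map (valueAtZero n)) w = z := by
        rw [hw, Matrix.mulVec_mulVec, ← Matrix.map_mul, hR,
          Matrix.map_one _ (map_zero _) (map_one _), Matrix.one_mulVec]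
      have hz' : ∀ i, z i = w 0 * b i +
          ∑ j : Fin n, w j.succ * valueAtZero n (partialDerivation j (Φ i)) := fun i => by
        rw [← congrFun hz i, Matrix.mulVec, dotProduct, Fin.sum_univ_succ]
        simp [frameMatrix, hb, mul_comm]
      have hℓz : eval z ℓ = w 0 := by
        have : eval z ℓ = ∑ i, c i * z i := by simp [hℓ]
        rw [this]
        calc ∑ i, c i * z i = w 0 * ∑ i, c i * b i +
              ∑ j : Fin n, w j.succ *
                ∑ i, c i * valueAtZero n (partialDerivation j (Φ i)) := by
              simp only [Finset.mul_sum]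
              rw [Finset.sum_comm, ← Finset.sum_add_distrib]
              refine Finset.sum_congr rfl fun i _ => ?_
              rw [hz', mul_add, Finset.mul_sum]
              congr 1
              · ring
              · exact Finset.sum_congr rfl fun j _ => by ring
          _ = w 0 := by simp [hcb, hcL]
      have h5 : eval z (aeval (fun i => X i - ℓ * C (b i)) P) =
          eval (fun i => z i - eval z ℓ * b i) P := by
        simp only [eval_aeval_eq, map_sub, map_mul, eval_X, eval_C]
      rw [h5, map_zero, ← h3 fun j => w j.succ]
      congr 2
      ext i
      rw [hℓz, hz']
      ring
    have h5 : Q ∈ Ideal.span {ℓ - 1} := by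
      have := aeval_sub_aeval_mem (J := Ideal.span {ℓ - 1}) (x := fun i => X i - C (b i))
        (y := fun i => X i - ℓ * C (b i)) (fun i => by
          rw [show X i - C (b i) - (X i - ℓ * C (b i)) = C (b i) * (ℓ - 1) by ring]
          exact Ideal.mul_mem_left _ _ (Ideal.mem_span_singleton_self _)) P
      rwa [h4, sub_zero] at this
    rw [show A * (ℓ - 1) + F₁ = (A * (ℓ - 1) + Q) + (F₁ - Q) by ring]
    exact add_mem (Ideal.mem_sup_left (add_mem
      (Ideal.mul_mem_left _ _ (Ideal.mem_span_singleton_self _)) h5)) (Ideal.mem_sup_right hPF)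

theorem rank_quotient_map_aeval (hb : ∀ i, valueAtZero n (Φ i) = b i)
    (hΦ : IsUnit (frameMatrix partialDerivation Φ)) {c : Fin (n + 1) → ℂ}
    (hc : aeval Φ (∑ i, C (c i) * X i : MvPolynomial (Fin (n + 1)) ℂ) = 1)
    (I : Ideal (MvPolynomial (Fin (n + 1)) ℂ)) {N : ℕ}
    (hN : pointIdeal b ^ N ≤ I ⊔ Ideal.span {∑ i, C (c i) * X i - 1} ⊔ pointIdeal b ^ (N + 1)) :
    Module.rank ℂ (analyticGerms n ⧸ I.map (aeval Φ : _ →ₐ[ℂ] analyticGerms n)) =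
      Module.rank ℂ (MvPolynomial (Fin (n + 1)) ℂ ⧸
        (I ⊔ Ideal.span {∑ i, C (c i) * X i - 1} ⊔ pointIdeal b ^ N)) := by
  set ℓ : MvPolynomial (Fin (n + 1)) ℂ := ∑ i, C (c i) * X i with hℓ
  set ψ : MvPolynomial (Fin (n + 1)) ℂ →ₐ[ℂ] analyticGerms n := aeval Φ with hψ
  have hℓ0 : (Ideal.span {ℓ - 1}).map ψ = ⊥ := by
    rw [Ideal.map_span, Set.image_singleton, map_sub, hc, map_one, sub_self,
      Ideal.span_singleton_eq_bot]
  have hpow : ∀ s, (pointIdeal b ^ s).map ψ = maximalIdeal n ^ s := fun s => by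
    rw [Ideal.map_pow, hψ, map_pointIdeal hb hΦ]
  have hle : maximalIdeal n ^ N ≤ I.map ψ := by
    refine Submodule.le_of_le_smul_of_le_jacobson_bot (I := maximalIdeal n)
      (Submodule.FG.pow maximalIdeal_fg N) maximalIdeal_le_jacobson_bot ?_
    have := Ideal.map_mono (f := ψ) hN
    rwa [Ideal.map_sup, Ideal.map_sup, hℓ0, sup_bot_eq, hpow, hpow, pow_succ'] at this
  rw [sup_assoc]
  refine rank_quotient_map ψ (𝔟 := maximalIdeal n ^ N)
    (exists_sub_mem_maximalIdeal_pow hb hΦ N) hle ?_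
    (mem_of_aeval_mem_maximalIdeal_pow hb hΦ hc N)
  rw [Ideal.map_sup, hℓ0, hpow, bot_sup_eq]

end Comparison

end

noncomputable section

/-! ### The Chinese remainder theorem for a product of powers -/

section CRT

theorem rank_pi_fin_eq_sum {K : Type} [Field K] (p : ℕ) (M : Fin p → Type)
    [∀ i, AddCommGroup (M i)] [∀ i, Module K (M i)] :
    Module.rank K (∀ i, M i) = ∑ i, Module.rank K (M i) := by
  induction p with
  | zero => simp
  | succ p ih =>
    rw [← (Fin.consLinearEquiv K M).rank_eq, rank_prod', ih, Fin.sum_univ_succ]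

variable {A : Type} [CommRing A]

theorem prod_sup_le {ι : Type*} (s : Finset ι) (K : Ideal A) (J : ι → Ideal A) :
    ∏ i ∈ s, (K ⊔ J i) ≤ K ⊔ ∏ i ∈ s, J i := by
  classical
  induction s using Finset.induction with
  | empty => simp
  | insert a s ha ih =>
    rw [Finset.prod_insert ha, Finset.prod_insert ha]
    refine (Ideal.mul_mono_right ih).trans ?_
    rw [Ideal.sup_mul, Ideal.mul_sup, Ideal.mul_sup]
    exact sup_le (sup_le (Ideal.mul_le_right.trans le_sup_left) (Ideal.mul_le_left.trans le_sup_left))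
      (sup_le (Ideal.mul_le_right.trans le_sup_left) le_sup_right)

theorem pow_le_sup_pow_succ {ι : Type*} [Fintype ι] {K : Ideal A} {J : ι → Ideal A}
    (hJ : Pairwise (Function.onFun IsCoprime J)) {N : ℕ} (h : ∏ i, J i ^ N ≤ K) (i : ι) :
    J i ^ N ≤ K ⊔ J i ^ (N + 1) := by
  classical
  have h1 : IsCoprime (J i) (∏ j ∈ Finset.univ.erase i, J j ^ N) :=
    IsCoprime.prod_right fun j hj => (hJ (Finset.ne_of_mem_erase hj).symm).pow_right
  have h2 := Ideal.isCoprime_iff_sup_eq.1 h1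
  calc J i ^ N = J i ^ N * (J i ⊔ ∏ j ∈ Finset.univ.erase i, J j ^ N) := by rw [h2, Ideal.mul_top]
    _ = J i ^ (N + 1) ⊔ ∏ j, J j ^ N := by
      rw [Ideal.mul_sup, ← pow_succ, Finset.mul_prod_erase _ (fun j => J j ^ N) (Finset.mem_univ i)]
    _ ≤ K ⊔ J i ^ (N + 1) := sup_le le_sup_right (h.trans le_sup_left)

theorem rank_quotient_eq_sum [Algebra ℂ A] {p : ℕ} {K : Ideal A} {J : Fin p → Ideal A}
    (hJ : Pairwise (Function.onFun IsCoprime J)) {N : ℕ} (h : ∏ i, J i ^ N ≤ K) :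
    Module.rank ℂ (A ⧸ K) = ∑ i, Module.rank ℂ (A ⧸ (K ⊔ J i ^ N)) := by
  have hco : Pairwise (Function.onFun IsCoprime fun i => K ⊔ J i ^ N) := fun i j hij => by
    have := Ideal.isCoprime_iff_sup_eq.1 ((hJ hij).pow (m := N) (n := N))
    exact Ideal.isCoprime_iff_sup_eq.2 (top_unique (this.ge.trans
      (sup_le_sup le_sup_right le_sup_right)))
  have hinf : ⨅ i, (K ⊔ J i ^ N) = K := by
    refine le_antisymm ?_ (le_iInf fun i => le_sup_left)
    have := Ideal.prod_eq_iInf_of_pairwise_isCoprime (s := Finset.univ)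
      (J := fun i => K ⊔ J i ^ N) (hco.set_pairwise _)
    simp only [Finset.mem_univ, iInf_pos] at this
    rw [← this]
    exact (prod_sup_le _ _ _).trans (sup_le le_rfl h)
  rw [← rank_pi_fin_eq_sum]
  conv_lhs => rw [← hinf]
  let e := Ideal.quotientInfRingEquivPiQuotient (fun i => K ⊔ J i ^ N) hco
  have he : ∀ (c : ℂ) (x), e (c • x) = c • e x := fun c x => by
    obtain ⟨x, rfl⟩ := Ideal.Quotient.mk_surjective x
    rfl
  exact LinearEquiv.rank_eq { e with map_smul' := he }

end CRT

/-! ### Local Hessian algebras as localizations -/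

section LocalEquation

open MvPolynomial analyticGerms

variable {n : ℕ}

theorem isUnit_frameMatrix_of_injective {φ : (Fin n → ℂ) → Fin (n + 1) → ℂ}
    (hφ : AnalyticAt ℂ φ 0)
    (hinj : Function.Injective fun z : ℂ × (Fin n → ℂ) => z.1 • φ 0 + fderiv ℂ φ 0 z.2) :
    IsUnit (frameMatrix partialDerivation
      fun i => of (fun y => φ y i) (analyticAt_pi_iff.1 hφ i)) := by
  refine isUnit_matrix_of_det_ne_zero _ fun hdet => ?_
  obtain ⟨v, hv, h0⟩ := Matrix.exists_mulVec_eq_zero_iff.2 hdet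
  have hd : ∀ i w, fderiv ℂ (fun y => φ y i) 0 w = fderiv ℂ φ 0 w i := fun i w => by
    rw [(hasFDerivAt_pi'.1 hφ.differentiableAt.hasFDerivAt i).fderiv]
    rfl
  have h1 : v 0 • φ 0 + fderiv ℂ φ 0 (fun j => v j.succ) = 0 := by
    ext i
    have h2 := congrFun h0 i
    rw [Matrix.mulVec, dotProduct, Fin.sum_univ_succ] at h2
    have h3 : fderiv ℂ φ 0 (fun j => v j.succ) =
        ∑ j : Fin n, v j.succ • fderiv ℂ φ 0 (Pi.single j 1) := by
      calc fderiv ℂ φ 0 (fun j => v j.succ) =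
          fderiv ℂ φ 0 (∑ j : Fin n, v j.succ • Pi.single j 1) :=
            congrArg _ (pi_eq_sum_univ' fun j : Fin n => v j.succ)
        _ = _ := by simp only [map_sum, map_smul]
    rw [h3]
    simp only [frameMatrix, Matrix.map_apply, Matrix.of_apply, Fin.cons_zero, Fin.cons_succ,
      valueAtZero_of, valueAtZero_partialDerivation_of, hd, Pi.zero_apply] at h2
    simp only [Pi.add_apply, Pi.smul_apply, smul_eq_mul, Finset.sum_apply, Pi.zero_apply]
    rw [← h2, mul_comm]
    congr 1
    exact Finset.sum_congr rfl fun j _ => mul_comm _ _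
  have h4 := @hinj (v 0, fun j => v j.succ) (0, 0) (by simpa using h1)
  refine hv (funext fun i => Fin.cases ?_ (fun j => ?_) i)
  · exact congrArg Prod.fst h4
  · exact congrFun (congrArg Prod.snd h4) j

theorem isUnit_frameMatrix_of_mul {O : Type*} [CommRing O] [Algebra ℂ O]
    (D : Fin n → Derivation ℂ O O) (u : O) (Φ : Fin (n + 1) → O)
    (h : IsUnit (frameMatrix D fun i => u * Φ i)) : IsUnit (frameMatrix D Φ) := by
  let T : Matrix (Fin (n + 1)) (Fin (n + 1)) O := Matrix.of
    (Fin.cons (Fin.cons u fun j => D j u)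
      fun i => Fin.cons 0 fun j => if i = j then u else 0)
  have hT : frameMatrix D (fun i => u * Φ i) = frameMatrix D Φ * T := by
    ext i j
    rw [Matrix.mul_apply, Fin.sum_univ_succ]
    refine Fin.cases ?_ (fun j => ?_) j
    · simp [T, frameMatrix, mul_comm]
    · simp [T, frameMatrix, Derivation.leibniz, add_comm, mul_comm]
  rw [Matrix.isUnit_iff_isUnit_det] at h ⊢
  rw [hT, Matrix.det_mul] at h
  exact isUnit_of_mul_isUnit_left h

/-- The representative of the projective point `a` in the hyperplane `∑ c_i x_i = 1`. -/
def normalizedRep (c : Fin (n + 1) → ℂ) (a : ℙ ℂ (Fin (n + 1) → ℂ)) : Fin (n + 1) → ℂ :=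
  fun i => (∑ l, c l * a.rep l)⁻¹ * a.rep i

theorem eq_normalizedRep {c : Fin (n + 1) → ℂ} {z : Fin (n + 1) → ℂ} (hz : z ≠ 0)
    (i : Fin (n + 1)) :
    normalizedRep c (Projectivization.mk ℂ z hz) i = (∑ l, c l * z l)⁻¹ * z i := by
  obtain ⟨t, ht⟩ := Projectivization.exists_smul_eq_mk_rep ℂ z hz
  have ht' : ∀ l, (Projectivization.mk ℂ z hz).rep l = t * z l := fun l => by rw [← ht]; rfl
  have ht0 : (t : ℂ) ≠ 0 := t.ne_zero
  simp only [normalizedRep, ht']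
  have : ∑ l, c l * (t * z l) = t * ∑ l, c l * z l := by
    rw [Finset.mul_sum]
    exact Finset.sum_congr rfl fun l _ => by ring
  rw [this, mul_inv]
  field_simp

theorem hessianNumber_eq_rank {d : ℕ} (hd : 0 < d) {f : MvPolynomial (Fin (n + 1)) ℂ}
    (hf : f.IsHomogeneous d) {a : ℙ ℂ (Fin (n + 1) → ℂ)} {g : analyticGerms n}
    (hg : IsLocalEquation f a g) {c : Fin (n + 1) → ℂ} (hc : ∑ l, c l * a.rep l ≠ 0) (k : ℕ)
    {N : ℕ}
    (hN : pointIdeal (normalizedRep c a) ^ N ≤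
      (jacobianIdeal f ⊔ minorsIdeal k (hessianMatrix f)) ⊔
        Ideal.span {∑ i, C (c i) * X i - 1} ⊔ pointIdeal (normalizedRep c a) ^ (N + 1)) :
    hessianNumber k g = Module.rank ℂ (MvPolynomial (Fin (n + 1)) ℂ ⧸
      ((jacobianIdeal f ⊔ minorsIdeal k (hessianMatrix f)) ⊔
        Ideal.span {∑ i, C (c i) * X i - 1} ⊔ pointIdeal (normalizedRep c a) ^ N)) := by
  obtain ⟨φ, u, ⟨hφ, ⟨hφ0, rfl⟩, hinj⟩, hu, hu0, hgφ⟩ := hg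
  have hφi : ∀ i, AnalyticAt ℂ (fun y => φ y i) 0 := analyticAt_pi_iff.1 hφ
  set L : (Fin n → ℂ) → ℂ := fun y => ∑ l, c l * φ y l with hL
  have hLa : AnalyticAt ℂ L 0 := Finset.univ.analyticAt_fun_sum fun l _ =>
    analyticAt_const.mul (hφi l)
  have hL0 : L 0 ≠ 0 := by
    intro h0
    obtain ⟨t, ht⟩ := Projectivization.exists_smul_eq_mk_rep ℂ (φ 0) hφ0
    refine hc ?_
    rw [← ht]
    calc ∑ l, c l * (t • φ 0) l = t * L 0 := by
          rw [hL, Finset.mul_sum]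
          exact Finset.sum_congr rfl fun l _ => by
            change c l * (t * φ 0 l) = _
            ring
      _ = 0 := by rw [h0, mul_zero]
  have hLne : ∀ᶠ y in 𝓝 0, L y ≠ 0 := hLa.continuousAt.eventually_ne hL0
  have hφ'i : ∀ i, AnalyticAt ℂ (fun y => (L y)⁻¹ * φ y i) 0 := fun i => (hLa.inv hL0).mul (hφi i)
  set Φ : Fin (n + 1) → analyticGerms n := fun i => of _ (hφ'i i) with hΦ
  have hcoe := fun P => coe_aeval_eq (Φ := Φ) (φ := fun y i => (L y)⁻¹ * φ y i) (fun i => rfl) P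
  have hb : ∀ i, valueAtZero n (Φ i) = normalizedRep c (Projectivization.mk ℂ (φ 0) hφ0) i :=
    fun i => (eq_normalizedRep hφ0 i).symm
  have hframe : IsUnit (frameMatrix partialDerivation Φ) := by
    refine isUnit_frameMatrix_of_mul _ (of L hLa) _ ?_
    convert isUnit_frameMatrix_of_injective hφ hinj using 3 with i
    refine Subtype.ext (Germ.coe_eq.2 ?_)
    filter_upwards [hLne] with y hy
    exact mul_inv_cancel_left₀ hy _
  have hℓ : aeval Φ (∑ i, C (c i) * X i : MvPolynomial (Fin (n + 1)) ℂ) = 1 := by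
    refine Subtype.ext ((hcoe _).trans (Germ.coe_eq.2 ?_))
    filter_upwards [hLne] with y hy
    have : ∑ i, c i * ((L y)⁻¹ * φ y i) = (L y)⁻¹ * L y := by
      rw [hL, Finset.mul_sum]
      exact Finset.sum_congr rfl fun l _ => by ring
    simpa [hy] using this
  have hgΦ : g = of u hu * of L hLa ^ d * aeval Φ f := by
    refine Subtype.ext (hgφ.trans ?_)
    rw [Subalgebra.coe_mul, hcoe, Subalgebra.coe_mul, Subalgebra.coe_pow]
    refine Germ.coe_eq.2 ?_
    filter_upwards [hLne] with y hy
    change u y * eval (φ y) f = u y * L y ^ d * eval (fun i => (L y)⁻¹ * φ y i) f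
    rw [hf.eval_const_mul, mul_assoc, ← mul_assoc (L y ^ d), ← mul_pow, mul_inv_cancel₀ hy, one_pow,
      one_mul]
  have hU : IsUnit (of u hu * of L hLa ^ d) :=
    (isUnit_of_valueAtZero_ne_zero (g := of u hu) hu0).mul
      ((isUnit_of_valueAtZero_ne_zero (g := of L hLa) hL0).pow d)
  have hideal : localHessianIdeal k g =
      (jacobianIdeal f ⊔ minorsIdeal k (hessianMatrix f)).map
        (aeval Φ : _ →ₐ[ℂ] analyticGerms n) := by
    rw [map_hessianIdeal_eq partialDerivation Φ hframe hd hf hU k, ← hgΦ]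
    rfl
  change Module.rank ℂ (analyticGerms n ⧸ localHessianIdeal k g) = _
  rw [hideal]
  exact rank_quotient_map_aeval hb hframe hℓ _ hN

end LocalEquation

/-! ### The singular points in a generic affine chart -/

section Global

open MvPolynomial

variable {n : ℕ}

theorem exists_forall_sum_mul_ne_zero {ι : Type*} [Finite ι] {v : ι → Fin (n + 1) → ℂ}
    (hv : ∀ i, v i ≠ 0) : ∃ c : Fin (n + 1) → ℂ, ∀ i, ∑ l, c l * v i l ≠ 0 := by
  cases nonempty_fintype ι
  have hP : (∏ i, ∑ l, C (v i l) * X l : MvPolynomial (Fin (n + 1)) ℂ) ≠ 0 := by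
    refine Finset.prod_ne_zero_iff.2 fun i _ h => hv i (funext fun l => ?_)
    have := congrArg (eval (Pi.single l 1)) h
    simpa [Pi.single_apply] using this
  by_contra! hcon
  refine hP (MvPolynomial.funext fun c => ?_)
  obtain ⟨i, hi⟩ := hcon c
  rw [map_zero, map_prod]
  refine Finset.prod_eq_zero (Finset.mem_univ i) ?_
  rw [← hi]
  simp [mul_comm]

/-- A common zero of the partial derivatives represents a singular point. -/
theorem mk_mem_singularLocus {d : ℕ} (hd : 0 < d) {f : MvPolynomial (Fin (n + 1)) ℂ}
    (hf : f.IsHomogeneous d) {z : Fin (n + 1) → ℂ} (hz : z ≠ 0)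
    (h : ∀ i, eval z (pderiv i f) = 0) : Projectivization.mk ℂ z hz ∈ singularLocus f := by
  obtain ⟨t, ht⟩ := Projectivization.exists_smul_eq_mk_rep ℂ z hz
  have ht' : (Projectivization.mk ℂ z hz).rep = fun l => (t : ℂ) * z l := by rw [← ht]; rfl
  have hfz : eval z f = 0 := by
    have := congrArg (eval z) hf.sum_X_mul_pderiv
    simp only [map_sum, map_mul, h, mul_zero, Finset.sum_const_zero, map_nsmul] at this
    simpa [hd.ne'] using this.symm
  refine ⟨?_, fun i => ?_⟩
  · rw [ht', hf.eval_const_mul, hfz, mul_zero]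
  · rw [ht', hf.pderiv.eval_const_mul, h, mul_zero]

theorem pow_le_of_forall_eval_eq_zero {J K : Ideal (MvPolynomial (Fin (n + 1)) ℂ)}
    (h : ∀ z : Fin (n + 1) → ℂ, (∀ F ∈ K, eval z F = 0) → ∀ F ∈ J, eval z F = 0) :
    ∃ N, J ^ N ≤ K := by
  refine Ideal.exists_pow_le_of_le_radical_of_fg ?_ (IsNoetherian.noetherian J)
  rw [← vanishingIdeal_zeroLocus_eq_radical (K := ℂ) K]
  intro F hF z hz
  simp only [mem_zeroLocus_iff, aeval_eq_eval] at hz ⊢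
  exact h z hz F hF

theorem isCoprime_pointIdeal {b b' : Fin (n + 1) → ℂ} (h : b ≠ b') :
    IsCoprime (pointIdeal b) (pointIdeal b') := by
  obtain ⟨i, hi⟩ := Function.ne_iff.1 h
  have hi' : b' i - b i ≠ 0 := sub_ne_zero.2 hi.symm
  refine Ideal.isCoprime_iff_sup_eq.2 ((Ideal.eq_top_iff_one _).2 ?_)
  have h1 : (X i - C (b i)) - (X i - C (b' i)) ∈ pointIdeal b ⊔ pointIdeal b' :=
    sub_mem (Ideal.mem_sup_left (Ideal.subset_span ⟨i, rfl⟩))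
      (Ideal.mem_sup_right (Ideal.subset_span ⟨i, rfl⟩))
  have h2 := Ideal.mul_mem_left _ (C (b' i - b i)⁻¹) h1
  rwa [sub_sub_sub_cancel_left, ← C_sub, ← C_mul, inv_mul_cancel₀ hi', C_1] at h2

end Global

end

theorem theorem1 (n d p : ℕ) (hd : 0 < d) (f : MvPolynomial (Fin (n + 1)) ℂ)
    (hf : f.IsHomogeneous d) (hf0 : f ≠ 0)
    (a : Fin p → ℙ ℂ (Fin (n + 1) → ℂ)) (ha : Function.Injective a)
    (hsing : Set.range a = singularLocus f) :
    ∀ k : ℕ, 1 ≤ k → k ≤ n + 1 → ∃ m₀ : ℕ, ∀ m : ℕ, m₀ ≤ m →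
      ∀ g : Fin p → analyticGerms n, (∀ i, IsLocalEquation f (a i) (g i)) →
        Module.rank ℂ (hessianAlgebraPiece k f m) = ∑ i, hessianNumber k (g i) := by
  intro k _ _
  obtain ⟨c, hc⟩ := exists_forall_sum_mul_ne_zero fun i => (a i).rep_nonzero
  set I := jacobianIdeal f ⊔ minorsIdeal k (hessianMatrix f) with hI
  set ℓ : MvPolynomial (Fin (n + 1)) ℂ := ∑ i, MvPolynomial.C (c i) * MvPolynomial.X i with hℓ
  have hℓz : ∀ z, MvPolynomial.eval z ℓ = ∑ i, c i * z i := fun z => by simp [hℓ]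
  have hℓhom : ℓ.IsHomogeneous 1 :=
    MvPolynomial.IsHomogeneous.sum _ _ _ fun i _ => MvPolynomial.isHomogeneous_C_mul_X _ _
  have hJI : ∀ i, MvPolynomial.pderiv i f ∈ I := fun i =>
    Ideal.mem_sup_left (Ideal.subset_span ⟨i, rfl⟩)
  have hsingz : ∀ z : Fin (n + 1) → ℂ, ∀ hz : z ≠ 0, (∀ F ∈ I, MvPolynomial.eval z F = 0) →
      ∃ i, a i = Projectivization.mk ℂ z hz := fun z hz h =>
    hsing.ge (mk_mem_singularLocus hd hf hz fun i => h _ (hJI i))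
  -- no common zero at infinity
  obtain ⟨M, hM⟩ : ∃ M, MvPolynomial.idealOfVars (Fin (n + 1)) ℂ ^ M ≤ I ⊔ Ideal.span {ℓ} := by
    refine pow_le_of_forall_eval_eq_zero fun z hz => ?_
    have hz0 : z = 0 := by
      by_contra hne
      obtain ⟨i, hi⟩ := hsingz z hne fun F hF => hz F (Ideal.mem_sup_left hF)
      refine hc i ?_
      obtain ⟨t, ht⟩ := Projectivization.exists_smul_eq_mk_rep ℂ z hne
      have h1 : ∑ l, c l * z l = 0 := by
        rw [← hℓz]
        exact hz ℓ (Ideal.mem_sup_right (Ideal.mem_span_singleton_self _))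
      rw [hi, ← ht]
      calc ∑ l, c l * (t • z) l = t * ∑ l, c l * z l := by
            rw [Finset.mul_sum]
            exact Finset.sum_congr rfl fun l _ => by
              change c l * (t * z l) = _
              ring
        _ = 0 := by rw [h1, mul_zero]
    have hle : MvPolynomial.idealOfVars (Fin (n + 1)) ℂ ≤ RingHom.ker (MvPolynomial.eval z) := by
      rw [MvPolynomial.idealOfVars, Ideal.span_le]
      rintro _ ⟨i, rfl⟩
      simp [hz0]
    exact fun F hF => hle hF
  obtain ⟨m₀, hm₀⟩ := exists_rank_map_mk_homogeneousSubmodule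
    (fun F hF m => homogeneousComponent_mem_hessianIdeal hf k hF m) hℓhom hM
  refine ⟨m₀, fun m hm g hg => (hm₀ m hm).trans ?_⟩
  set K := I ⊔ Ideal.span {ℓ - 1} with hK
  set b : Fin p → Fin (n + 1) → ℂ := fun i => normalizedRep c (a i) with hb
  have hbinj : Function.Injective b := by
    intro i j hij
    refine ha ?_
    rw [← (a i).mk_rep, ← (a j).mk_rep, Projectivization.mk_eq_mk_iff']
    refine ⟨(∑ l, c l * (a i).rep l) * (∑ l, c l * (a j).rep l)⁻¹, funext fun l => ?_⟩
    have h1 := congrFun hij l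
    simp only [hb, normalizedRep] at h1
    rw [Pi.smul_apply, smul_eq_mul, mul_assoc, ← h1, mul_inv_cancel_left₀ (hc i)]
  have hcop : Pairwise (Function.onFun IsCoprime fun i => pointIdeal (b i)) := fun i j hij =>
    isCoprime_pointIdeal (hbinj.ne hij)
  obtain ⟨N, hN⟩ : ∃ N, (∏ i, pointIdeal (b i)) ^ N ≤ K := by
    refine pow_le_of_forall_eval_eq_zero fun z hz F hF => ?_
    have h1 : ∑ l, c l * z l = 1 := by
      have := hz (ℓ - 1) (Ideal.mem_sup_right (Ideal.mem_span_singleton_self _))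
      rw [map_sub, hℓz, map_one] at this
      exact sub_eq_zero.1 this
    have hz0 : z ≠ 0 := by
      rintro rfl
      simp at h1
    obtain ⟨i, hi⟩ := hsingz z hz0 fun F hF => hz F (Ideal.mem_sup_left hF)
    have hbz : b i = z := funext fun l => by
      simp only [hb, hi]
      rw [eq_normalizedRep, h1, inv_one, one_mul]
    have h2 : F ∈ pointIdeal (b i) :=
      (Ideal.prod_le_inf.trans (Finset.inf_le (Finset.mem_univ i))) hF
    rw [mem_pointIdeal_iff, hbz] at h2
    exact h2
  rw [← Finset.prod_pow] at hN
  rw [rank_quotient_eq_sum hcop hN]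
  exact Finset.sum_congr rfl fun i _ =>
    (hessianNumber_eq_rank hd hf (hg i) (hc i) k (pow_le_sup_pow_succ hcop hN i)).symm
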